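/- **Setting.** Let $a<b$ and let $\beta,\sigma,\tau:\mathbb R\to\mathbb R$ be Lipschitz with $\beta<\sigma<\tau$ on $[a,b]$. Put $\Omega_f=\{a<x<b,\ \beta(x)<y<\sigma(x)\}$, $\Omega_s=\{a<x<b,\ \sigma(x)<y<\tau(x)\}$, with interface $\Sigma=\{(x,\sigma(x)):a<x<b\}$, bottom side $\Gamma_D^f=\{(x,\beta(x))\}$, top side $\Gamma_D^s=\{(x,\tau(x))\}$ ($a<x<b$), and let $\Gamma_N^f,\Gamma_N^s$ be the vertical sides of $\Omega_f,\Omega_s$. Let $n_f=-n_s$ be the unit normal on $\Sigma$ pointing out of $\Omega_f$, let $(\cdot,\cdot)_i$ be the inner product of $L^2(\Omega_i)$, $i=f,s$, and $\langle\cdot,\cdot\rangle$ that of $L^2(\Sigma)$ (arclength). Let $\nu_f,\nu_s,\alpha,T>0$ be constants. *Exact solution.* Let $u,w$ be $C^2$ up to the boundary (that is, restrictions of $C^2$ functions of $(t,x,y)\in\mathbb R^3$) on $[0,T]\times\overline{\Omega_f}$ and $[0,T]\times\overline{\Omega_s}$, with, for all $t\in[0,T]$: $\partial_tu-\nu_f\Delta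 u=0$ in $\Omega_f$ and $\partial_tw-\nu_s\Delta w=0$ in $\Omega_s$; $u=0$ on $\Gamma_D^f$ and $w=0$ on $\Gamma_D^s$; $\partial_nu=0$ on $\Gamma_N^f$ and $\partial_nw=0$ on $\Gamma_N^s$; and $w=u$, $\nu_s\nabla w\cdot n_s+\nu_f\nabla u\cdot n_f=0$ on $\Sigma$ (the latter wherever $\sigma$ is differentiable). Put $l=\nu_f\nabla u\cdot n_f$ on $\Sigma$. *Prediction step.* Let $N\in\mathbb N$, $\Delta t>0$, $T=N\Delta t$, $t_n=n\Delta t$; $V_i=\{v\in H^1(\Omega_i): v=0 \text{ on } \Gamma_D^i\}$, $i=f,s$, and $V_g=L^2(\Sigma)$ (boundary values are traces). Let $w_0^0=w(0)$, $u_0^0=u(0)$, $\lambda_0^0=l(0)$, and for $0\le n<N$ let $w_0^{n+1}\in V_s$, $u_0^{n+1}\in V_f$, $\lambda_0^{n+1}\in V_g$ satisfy $$\Big(\tfrac{w_0^{n+1}-w_0^n}{\Delta t},z\Big)_s+\nu_s(\nabla w_0^{n+1},\nabla z)_s+\alpha\langle w_0^{n+1}-u_0^n,z\rangle+\langle\lambda_0^n,z\rangle=0\quad\forall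 z\in V_s,$$ $$\Big(\tfrac{u_0^{n+1}-u_0^n}{\Delta t},v\Big)_f+\nu_f(\nabla u_0^{n+1},\nabla v)_f-\langle\lambda_0^{n+1},v\rangle=0\quad\forall v\in V_f,$$ $$\langle\lambda_0^{n+1}-\lambda_0^n+\alpha(u_0^{n+1}-w_0^{n+1}),\mu\rangle=0\quad\forall\mu\in V_g.$$ Define the errors $U_0^n=u(t_n)-u_0^n$ and $\Lambda_0^n=l(t_n)-\lambda_0^n$. **Assumption (with constants $C,\mathsf Y$).** $U_0^{n+1}-U_0^n\in H^2(\Omega_f)$ for $0\le n<N$, and $$\max_{0\le n\le N-1}\|\nabla(U_0^{n+1}-U_0^n)\|^2_{L^2(\Omega_f)}+\Delta t\sum_{n=0}^{N-1}\|D^2(U_0^{n+1}-U_0^n)\|^2_{L^2(\Omega_f)}\le C(\Delta t)^4\mathsf Y .$$ **Corollary.** There is a constant $K>0$ that depends only on $a,b,\beta,\sigma,\tau$, $\nu_f$ and $T$ (not on $\nu_s,\alpha,N,\Delta t$, the exact solution, the discrete solution, $C$ or $\mathsf Y$) such that, whenever the Assumption holds with real numbers $C,\mathsf Y$, $$\Delta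 t\sum_{n=0}^{N-1}\|\Lambda_0^{n+1}-\Lambda_0^n\|^2_{L^2(\Sigma)}\le K\,C\,(\Delta t)^4\,\mathsf Y .$$ -/

import Mathlib

open MeasureTheory Filter Topology Set
open scoped ContDiff ENNReal

noncomputable section

namespace RobinCoupling

/-! ### Weak derivatives, Sobolev spaces and traces in the plane -/

/-- The coordinate directions of the plane `ℝ × ℝ`. -/
def dir (i : Fin 2) : ℝ × ℝ := if i = 0 then (1, 0) else (0, 1)

/-- The classical partial derivative `∂ᵢ f`. -/
def pd (i : Fin 2) (f : ℝ × ℝ → ℝ) (p : ℝ × ℝ) : ℝ := fderiv ℝ f p (dir i)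

/-- `g` is a weak partial derivative `∂ᵢ f` on the open set `Ω`. -/
def IsWeakPartial (Ω : Set (ℝ × ℝ)) (i : Fin 2) (f g : ℝ × ℝ → ℝ) : Prop :=
  ∀ φ : ℝ × ℝ → ℝ, ContDiff ℝ ∞ φ → HasCompactSupport φ → tsupport φ ⊆ Ω →
    ∫ p in Ω, f p * pd i φ p = - ∫ p in Ω, g p * φ p

/-- `f` has a weak partial derivative `∂ᵢ f` in `L²(Ω)`. -/
def HasWeakPartial (Ω : Set (ℝ × ℝ)) (i : Fin 2) (f : ℝ × ℝ → ℝ) : Prop :=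
  ∃ g : ℝ × ℝ → ℝ, MemLp g 2 (volume.restrict Ω) ∧ IsWeakPartial Ω i f g

open Classical in
/-- The weak partial derivative `∂ᵢ f ∈ L²(Ω)` (unique almost everywhere on the open set `Ω`);
zero if there is none. -/
def wpd (Ω : Set (ℝ × ℝ)) (i : Fin 2) (f : ℝ × ℝ → ℝ) : ℝ × ℝ → ℝ :=
  if h : HasWeakPartial Ω i f then h.choose else 0

/-- The Sobolev space `H¹(Ω)`. -/
def MemH1 (Ω : Set (ℝ × ℝ)) (f : ℝ × ℝ → ℝ) : Prop :=
  MemLp f 2 (volume.restrict Ω) ∧ ∀ i, HasWeakPartial Ω i f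

/-- The Sobolev space `H²(Ω)`. -/
def MemH2 (Ω : Set (ℝ × ℝ)) (f : ℝ × ℝ → ℝ) : Prop :=
  MemH1 Ω f ∧ ∀ i, MemH1 Ω (wpd Ω i f)

/-- `(∇f, ∇g)` in `L²(Ω)`. -/
def gradInner (Ω : Set (ℝ × ℝ)) (f g : ℝ × ℝ → ℝ) : ℝ :=
  ∫ p in Ω, ∑ i, wpd Ω i f p * wpd Ω i g p

/-- `‖∇f‖²` in `L²(Ω)`. -/
def gradNormSq (Ω : Set (ℝ × ℝ)) (f : ℝ × ℝ → ℝ) : ℝ :=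
  ∫ p in Ω, ∑ i, wpd Ω i f p ^ 2

/-- `‖D²f‖²` in `L²(Ω)`. -/
def hessNormSq (Ω : Set (ℝ × ℝ)) (f : ℝ × ℝ → ℝ) : ℝ :=
  ∫ p in Ω, ∑ i, ∑ j, wpd Ω i (wpd Ω j f) p ^ 2

/-- `t ∈ L²(S)` is the trace of `f ∈ H¹(Ω)` on a part `S` of the boundary with arclength
measure `S`: the closure of the restriction map `φ ↦ φ|_S` of smooth functions on the plane
with respect to the norms of `H¹(Ω)` and `L²(S)`. -/
def IsTrace (Ω : Set (ℝ × ℝ)) (S : Measure (ℝ × ℝ)) (f t : ℝ × ℝ → ℝ) : Prop :=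
  MemLp t 2 S ∧ ∃ φ : ℕ → ℝ × ℝ → ℝ, (∀ k, ContDiff ℝ ∞ (φ k)) ∧
    Tendsto (fun k => eLpNorm (φ k - f) 2 (volume.restrict Ω)) atTop (𝓝 0) ∧
    (∀ i, Tendsto (fun k => eLpNorm (pd i (φ k) - wpd Ω i f) 2 (volume.restrict Ω))
      atTop (𝓝 0)) ∧
    Tendsto (fun k => eLpNorm (φ k - t) 2 S) atTop (𝓝 0)

open Classical in
/-- The trace operator `H¹(Ω) → L²(S)`; zero if there is no trace. -/
def trace (Ω : Set (ℝ × ℝ)) (S : Measure (ℝ × ℝ)) (f : ℝ × ℝ → ℝ) : ℝ × ℝ → ℝ :=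
  if h : ∃ t, IsTrace Ω S f t then h.choose else 0

/-- `{v ∈ H¹(Ω) : v = 0 on S}`, the boundary values being taken in the sense of traces. -/
def MemV (Ω : Set (ℝ × ℝ)) (S : Measure (ℝ × ℝ)) (f : ℝ × ℝ → ℝ) : Prop :=
  MemH1 Ω f ∧ IsTrace Ω S f 0

/-- The arclength measure `√(1 + γ'(x)²) dx` on the graph `{(x, γ x) : a < x < b}`. -/
def arclength (a b : ℝ) (γ : ℝ → ℝ) : Measure (ℝ × ℝ) :=
  ((volume.restrict (Ioo a b)).withDensity
    fun x => ENNReal.ofReal (Real.sqrt (1 + deriv γ x ^ 2))).map fun x => (x, γ x)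

/-! ### The geometry -/

/-- A planar domain with two vertical sides `x = a`, `x = b`, a bottom side `y = bot x` and a top
side `y = top x`, cut by an interface `y = itf x` that joins the two vertical sides; the three
curves are Lipschitz graphs. -/
structure Domain where
  a : ℝ
  b : ℝ
  bot : ℝ → ℝ
  itf : ℝ → ℝ
  top : ℝ → ℝ
  a_lt_b : a < b
  lip_bot : ∃ L, LipschitzWith L bot
  lip_itf : ∃ L, LipschitzWith L itf
  lip_top : ∃ L, LipschitzWith L top
  bot_lt_itf : ∀ x ∈ Icc a b, bot x < itf x
  itf_lt_top : ∀ x ∈ Icc a b, itf x < top x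

namespace Domain

/-- `Ω_f`, the part below the interface. -/
def fluid (D : Domain) : Set (ℝ × ℝ) :=
  {p | p.1 ∈ Ioo D.a D.b ∧ D.bot p.1 < p.2 ∧ p.2 < D.itf p.1}

/-- `Ω_s`, the part above the interface. -/
def solid (D : Domain) : Set (ℝ × ℝ) :=
  {p | p.1 ∈ Ioo D.a D.b ∧ D.itf p.1 < p.2 ∧ p.2 < D.top p.1}

/-- The arclength measure of the interface `Σ`. -/
def sigma (D : Domain) : Measure (ℝ × ℝ) := arclength D.a D.b D.itf

/-- The arclength measure of `Γ_D^f`, the bottom side. -/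
def gammaF (D : Domain) : Measure (ℝ × ℝ) := arclength D.a D.b D.bot

/-- The arclength measure of `Γ_D^s`, the top side. -/
def gammaS (D : Domain) : Measure (ℝ × ℝ) := arclength D.a D.b D.top

/-- The unit normal of `Σ` that points out of `Ω_f`, at the point `p` of `Σ`. -/
def normalF (D : Domain) (p : ℝ × ℝ) (i : Fin 2) : ℝ :=
  (if i = 0 then - deriv D.itf p.1 else 1) / Real.sqrt (1 + deriv D.itf p.1 ^ 2)

/-- The unit normal of `Σ` that points out of `Ω_s`. -/
def normalS (D : Domain) (p : ℝ × ℝ) (i : Fin 2) : ℝ := - D.normalF p i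

end Domain

/-! ### The interface problem and the prediction step -/

/-- The classical flux `ν_f ∇u · n_f` on `Σ`. -/
def fluxF (D : Domain) (νf : ℝ) (u : ℝ → ℝ × ℝ → ℝ) (t : ℝ) (p : ℝ × ℝ) : ℝ :=
  νf * ∑ i, pd i (u t) p * D.normalF p i

/-- The classical flux `ν_s ∇w · n_s` on `Σ`. -/
def fluxS (D : Domain) (νs : ℝ) (w : ℝ → ℝ × ℝ → ℝ) (t : ℝ) (p : ℝ × ℝ) : ℝ :=
  νs * ∑ i, pd i (w t) p * D.normalS p i

/-- `(u, w)` is a classical solution on `[0, T]` of the parabolic-parabolic interface problem.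
Regularity up to the boundary: `u` (resp. `w`) is the restriction to `[0, T]` times the closure of
`Ω_f` (resp. `Ω_s`) of a function of class `C²` of all `(t, x)`; no condition is imposed
elsewhere. The initial data are `u 0` and `w 0`. -/
structure IsSolution (D : Domain) (νf νs T : ℝ) (u w : ℝ → ℝ × ℝ → ℝ) : Prop where
  smooth_u : ContDiff ℝ 2 fun q : ℝ × (ℝ × ℝ) => u q.1 q.2
  smooth_w : ContDiff ℝ 2 fun q : ℝ × (ℝ × ℝ) => w q.1 q.2
  heat_u : ∀ t ∈ Icc 0 T, ∀ p ∈ D.fluid,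
    deriv (fun s => u s p) t - νf * ∑ i, pd i (pd i (u t)) p = 0
  heat_w : ∀ t ∈ Icc 0 T, ∀ p ∈ D.solid,
    deriv (fun s => w s p) t - νs * ∑ i, pd i (pd i (w t)) p = 0
  dirichlet_u : ∀ t ∈ Icc 0 T, ∀ x ∈ Ioo D.a D.b, u t (x, D.bot x) = 0
  dirichlet_w : ∀ t ∈ Icc 0 T, ∀ x ∈ Ioo D.a D.b, w t (x, D.top x) = 0
  neumann_u : ∀ t ∈ Icc 0 T, ∀ x, x = D.a ∨ x = D.b → ∀ y ∈ Ioo (D.bot x) (D.itf x),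
    pd 0 (u t) (x, y) = 0
  neumann_w : ∀ t ∈ Icc 0 T, ∀ x, x = D.a ∨ x = D.b → ∀ y ∈ Ioo (D.itf x) (D.top x),
    pd 0 (w t) (x, y) = 0
  continuity : ∀ t ∈ Icc 0 T, ∀ x ∈ Ioo D.a D.b, w t (x, D.itf x) - u t (x, D.itf x) = 0
  flux_balance : ∀ t ∈ Icc 0 T, ∀ x ∈ Ioo D.a D.b, DifferentiableAt ℝ D.itf x →
    fluxS D νs w t (x, D.itf x) + fluxF D νf u t (x, D.itf x) = 0

/-- `(w₀ⁿ, u₀ⁿ, λ₀ⁿ)`, `0 ≤ n ≤ N`, are computed by the prediction step (the Robin-Robin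
loosely coupled scheme) with time step `dt`, started from the data `u 0`, `w 0`,
`ν_f ∇(u 0) · n_f` of `(u, w)`. -/
structure IsPrediction (D : Domain) (νf νs α dt : ℝ) (N : ℕ) (u w : ℝ → ℝ × ℝ → ℝ)
    (w₀ u₀ lam₀ : ℕ → ℝ × ℝ → ℝ) : Prop where
  init_w : w₀ 0 =ᵐ[volume.restrict D.solid] w 0
  init_u : u₀ 0 =ᵐ[volume.restrict D.fluid] u 0
  init_lam : lam₀ 0 =ᵐ[D.sigma] fluxF D νf u 0
  mem_w : ∀ n < N, MemV D.solid D.gammaS (w₀ (n + 1))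
  mem_u : ∀ n < N, MemV D.fluid D.gammaF (u₀ (n + 1))
  mem_lam : ∀ n < N, MemLp (lam₀ (n + 1)) 2 D.sigma
  step_w : ∀ n < N, ∀ z, MemV D.solid D.gammaS z →
    (∫ p in D.solid, (w₀ (n + 1) p - w₀ n p) / dt * z p)
      + νs * gradInner D.solid (w₀ (n + 1)) z
      + α * (∫ p, (trace D.solid D.sigma (w₀ (n + 1)) p - trace D.fluid D.sigma (u₀ n) p)
          * trace D.solid D.sigma z p ∂D.sigma)
      + (∫ p, lam₀ n p * trace D.solid D.sigma z p ∂D.sigma) = 0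
  step_u : ∀ n < N, ∀ v, MemV D.fluid D.gammaF v →
    (∫ p in D.fluid, (u₀ (n + 1) p - u₀ n p) / dt * v p)
      + νf * gradInner D.fluid (u₀ (n + 1)) v
      - (∫ p, lam₀ (n + 1) p * trace D.fluid D.sigma v p ∂D.sigma) = 0
  step_lam : ∀ n < N, ∀ μ : ℝ × ℝ → ℝ, MemLp μ 2 D.sigma →
    (∫ p, ((lam₀ (n + 1) p - lam₀ n p)
      + α * (trace D.fluid D.sigma (u₀ (n + 1)) p - trace D.solid D.sigma (w₀ (n + 1)) p))
        * μ p ∂D.sigma) = 0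

/-- The error `U₀ⁿ = u(n dt) - u₀ⁿ`. -/
def errU (dt : ℝ) (u : ℝ → ℝ × ℝ → ℝ) (u₀ : ℕ → ℝ × ℝ → ℝ) (n : ℕ) : ℝ × ℝ → ℝ :=
  fun p => u (n * dt) p - u₀ n p

/-- The error `Λ₀ⁿ = l(n dt) - λ₀ⁿ`, where `l = ν_f ∇u · n_f` on `Σ`. -/
def errLam (D : Domain) (νf dt : ℝ) (u : ℝ → ℝ × ℝ → ℝ) (lam₀ : ℕ → ℝ × ℝ → ℝ) (n : ℕ) :
    ℝ × ℝ → ℝ :=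
  fun p => fluxF D νf u (n * dt) p - lam₀ n p

/-- The second-order `H²` estimate for the increments `U₀ⁿ⁺¹ - U₀ⁿ`, `0 ≤ n < N`, that is assumed
of the prediction step: the increments are in `H²(Ω_f)` and
`max_m ‖∇(U₀ᵐ⁺¹ - U₀ᵐ)‖² + dt ∑ₙ ‖D²(U₀ⁿ⁺¹ - U₀ⁿ)‖² ≤ C dt⁴ Y`. -/
def IncrementEstimate (D : Domain) (dt : ℝ) (N : ℕ) (u : ℝ → ℝ × ℝ → ℝ)
    (u₀ : ℕ → ℝ × ℝ → ℝ) (C Y : ℝ) : Prop :=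
  (∀ n < N, MemH2 D.fluid (errU dt u u₀ (n + 1) - errU dt u u₀ n)) ∧
  ∀ m < N, gradNormSq D.fluid (errU dt u u₀ (m + 1) - errU dt u u₀ m)
    + dt * ∑ n ∈ Finset.range N, hessNormSq D.fluid (errU dt u u₀ (n + 1) - errU dt u u₀ n)
      ≤ C * dt ^ 4 * Y

end RobinCoupling

end

/-! The fluid step of the scheme says that $\lambda_0^{n+1}$ is the flux of $u_0^{n+1}$ through
$\Sigma$ in the weak sense given by Green's formula, with $(u_0^{n+1}-u_0^n)/\Delta t$ in the role
of $\nu_f\Delta u_0^{n+1}$. The exact flux $l$ is the weak flux of $u$ by classical integration by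
parts. Weak fluxes are linear (`HasWeakFlux.sub`), so $\Lambda_0^{n+1}-\Lambda_0^n$ is the weak flux
of $f=U_0^{n+1}-U_0^n$, which is in $H^2(\Omega_f)$ by assumption. It remains to bound the
$L^2(\Sigma)$ norm of the weak flux of an $H^2$ function by $\|\nabla f\|+\|D^2f\|$
(`exists_flux_estimate`) and to sum over $n$.

The bound is proved by duality, which avoids a trace theorem for $\nabla f$. Testing inside
$\Omega_f$ identifies the volume term with $\nu\Delta f$, so the flux paired with $h$ equals
$\nu\int(\Delta f\,v+\nabla f\cdot\nabla v)$ for any test function $v$ equal to $h$ on $\Sigma$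
(`HasWeakFlux.integral_eq`). `exists_test_extension` provides a $v$ with $|v|,|\partial_yv|\le
M|h(x)|$.

The obstacle is $\partial_xv$, which contains $h'$. The field $\partial_x+\sigma'\partial_y$ is
tangent to $\Sigma$, so integrating by parts along it leaves no boundary term: $\int F\,\partial_xv$
becomes integrals of $F\,\partial_yv$ and of $\nabla F\,v$ (`abs_integral_mul_pd_zero_le`). As
$\sigma$ is only Lipschitz, $\sigma'$ is replaced by slopes of smooth approximations with the same
Lipschitz bound. Cauchy-Schwarz and the density of smooth $h$ in $L^2(a,b)$ finish the estimate. -/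

noncomputable section

namespace RobinCoupling

/-! ### Graphs and arclength -/

/-- The density `√(1 + γ'²)` of the arclength of a graph. -/
def arcDensity (γ : ℝ → ℝ) (x : ℝ) : ℝ := Real.sqrt (1 + deriv γ x ^ 2)

lemma one_le_arcDensity (γ : ℝ → ℝ) (x : ℝ) : 1 ≤ arcDensity γ x :=
  Real.one_le_sqrt.2 (by nlinarith [sq_nonneg (deriv γ x)])

lemma measurable_arcDensity (γ : ℝ → ℝ) : Measurable (arcDensity γ) :=
  (((measurable_deriv γ).pow_const 2).const_add 1).sqrt

lemma abs_deriv_le_of_lipschitz {γ : ℝ → ℝ} {L : NNReal} (hγ : LipschitzWith L γ) (x : ℝ) :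
    |deriv γ x| ≤ L := by
  simpa using norm_deriv_le_of_lipschitz hγ (x₀ := x)

lemma arcDensity_le {γ : ℝ → ℝ} {L : NNReal} (hγ : LipschitzWith L γ) (x : ℝ) :
    arcDensity γ x ≤ 1 + L := by
  have h := abs_deriv_le_of_lipschitz hγ x
  rw [arcDensity, Real.sqrt_le_left (by positivity)]
  nlinarith [sq_abs (deriv γ x), abs_nonneg (deriv γ x), L.coe_nonneg]

lemma measurableEmbedding_graph {γ : ℝ → ℝ} (hγ : Continuous γ) :
    MeasurableEmbedding fun x => (x, γ x) := by
  have h : Topology.IsClosedEmbedding fun x => (x, γ x) :=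
    Topology.IsClosedEmbedding.of_continuous_injective_isClosedMap (by fun_prop)
      (fun x y hxy => congrArg Prod.fst hxy) (by
        intro s hs
        have : (fun x => (x, γ x)) '' s = {p : ℝ × ℝ | p.1 ∈ s ∧ p.2 = γ p.1} := by
          ext ⟨x, y⟩
          simp only [mem_image, Prod.mk.injEq, mem_ofPred_eq]
          constructor
          · rintro ⟨t, ht, rfl, rfl⟩; exact ⟨ht, rfl⟩
          · rintro ⟨hx, rfl⟩; exact ⟨x, hx, rfl, rfl⟩
        rw [this]
        exact (hs.preimage continuous_fst).inter
          (isClosed_eq continuous_snd (hγ.comp continuous_fst)))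
  exact h.measurableEmbedding

lemma integral_arclength {a b : ℝ} {γ : ℝ → ℝ} (hγ : Continuous γ) (f : ℝ × ℝ → ℝ) :
    ∫ p, f p ∂(arclength a b γ) = ∫ x in Ioo a b, arcDensity γ x * f (x, γ x) := by
  rw [arclength, (measurableEmbedding_graph hγ).integral_map,
    integral_withDensity_eq_integral_toReal_smul]
  · refine integral_congr_ae (ae_of_all _ fun x => ?_)
    simp only [smul_eq_mul]
    rw [ENNReal.toReal_ofReal (Real.sqrt_nonneg _), arcDensity]
  · exact (measurable_arcDensity γ).ennreal_ofReal
  · exact ae_of_all _ fun x => ENNReal.ofReal_lt_top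

/-- The arclength density is at least 1, so $L^2$ bounds and null sets pass from the graph to the
parameter interval. -/
lemma restrict_le_withDensity_arcDensity (a b : ℝ) (γ : ℝ → ℝ) :
    volume.restrict (Ioo a b) ≤ (volume.restrict (Ioo a b)).withDensity
      fun x => ENNReal.ofReal (Real.sqrt (1 + deriv γ x ^ 2)) := by
  conv_lhs => rw [← withDensity_one (μ := volume.restrict (Ioo a b))]
  refine withDensity_mono (ae_of_all _ fun x => ?_)
  rw [Pi.one_apply, ← ENNReal.ofReal_one]
  exact ENNReal.ofReal_le_ofReal (one_le_arcDensity γ x)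

lemma MemLp.comp_graph {a b : ℝ} {γ : ℝ → ℝ} (hγ : Continuous γ) {f : ℝ × ℝ → ℝ}
    (hf : MemLp f 2 (arclength a b γ)) :
    MemLp (fun x => f (x, γ x)) 2 (volume.restrict (Ioo a b)) := by
  rw [arclength, (measurableEmbedding_graph hγ).memLp_map_measure_iff] at hf
  exact hf.mono_measure (restrict_le_withDensity_arcDensity a b γ)

lemma eLpNorm_comp_graph_le {a b : ℝ} {γ : ℝ → ℝ} (hγ : Continuous γ) (f : ℝ × ℝ → ℝ) :
    eLpNorm (fun x => f (x, γ x)) 2 (volume.restrict (Ioo a b))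
      ≤ eLpNorm f 2 (arclength a b γ) := by
  rw [arclength, (measurableEmbedding_graph hγ).eLpNorm_map_measure]
  exact eLpNorm_mono_measure _ (restrict_le_withDensity_arcDensity a b γ)

lemma ae_arclength_of_forall {a b : ℝ} {γ : ℝ → ℝ} (hγ : Continuous γ) {P : ℝ × ℝ → Prop}
    (h : ∀ x ∈ Ioo a b, P (x, γ x)) : ∀ᵐ p ∂(arclength a b γ), P p := by
  rw [arclength, (measurableEmbedding_graph hγ).ae_map_iff]
  exact (withDensity_absolutelyContinuous _ _).ae_le
    ((ae_restrict_iff' measurableSet_Ioo).2 (ae_of_all _ h))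

lemma ae_comp_graph {a b : ℝ} {γ : ℝ → ℝ} (hγ : Continuous γ) {P : ℝ × ℝ → Prop}
    (h : ∀ᵐ p ∂(arclength a b γ), P p) : ∀ᵐ x ∂(volume.restrict (Ioo a b)), P (x, γ x) := by
  rw [arclength, (measurableEmbedding_graph hγ).ae_map_iff] at h
  exact (Measure.absolutelyContinuous_of_le
    (restrict_le_withDensity_arcDensity a b γ)).ae_le h

lemma isFiniteMeasure_arclength {a b : ℝ} {γ : ℝ → ℝ} {L : NNReal} (hL : LipschitzWith L γ) :
    IsFiniteMeasure (arclength a b γ) := by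
  have : IsFiniteMeasure ((volume.restrict (Ioo a b)).withDensity
      fun x => ENNReal.ofReal (Real.sqrt (1 + deriv γ x ^ 2))) := by
    refine isFiniteMeasure_withDensity ?_
    refine ((setLIntegral_mono (g := fun _ => ENNReal.ofReal (1 + L)) measurable_const
      (fun x _ => ENNReal.ofReal_le_ofReal (arcDensity_le hL x))).trans_lt ?_).ne
    simp [ENNReal.mul_lt_top_iff]
  unfold arclength
  infer_instance

/-! ### Partial derivatives of differentiable functions -/

lemma hasDerivAt_comp_pd {w : ℝ × ℝ → ℝ} {x x' y y' t : ℝ} {X Y : ℝ → ℝ}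
    (hw : DifferentiableAt ℝ w (x, y)) (hx : X t = x) (hy : Y t = y)
    (hX : HasDerivAt X x' t) (hY : HasDerivAt Y y' t) :
    HasDerivAt (fun s => w (X s, Y s)) (x' * pd 0 w (x, y) + y' * pd 1 w (x, y)) t := by
  subst hx hy
  have h := hw.hasFDerivAt.comp_hasDerivAt t (hX.prodMk hY)
  have e : ((x', y') : ℝ × ℝ) = x' • dir 0 + y' • dir 1 := by simp [dir]
  rw [e, map_add, map_smul, map_smul] at h
  exact h

lemma continuous_pd {w : ℝ × ℝ → ℝ} (hw : ContDiff ℝ 1 w) (i : Fin 2) : Continuous (pd i w) :=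
  (hw.continuous_fderiv one_ne_zero).clm_apply continuous_const

lemma tsupport_pd_subset (w : ℝ × ℝ → ℝ) (i : Fin 2) : tsupport (pd i w) ⊆ tsupport w :=
  tsupport_fderiv_apply_subset ℝ (dir i)

lemma hasCompactSupport_pd {w : ℝ × ℝ → ℝ} (hw : HasCompactSupport w) (i : Fin 2) :
    HasCompactSupport (pd i w) :=
  hw.fderiv_apply ℝ (dir i)

lemma contDiff_pd {w : ℝ × ℝ → ℝ} {m n : WithTop ℕ∞} (hw : ContDiff ℝ n w) (hmn : m + 1 ≤ n)
    (i : Fin 2) : ContDiff ℝ m (pd i w) :=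
  (hw.fderiv_right hmn).clm_apply contDiff_const

lemma pd_mul {f g : ℝ × ℝ → ℝ} {p : ℝ × ℝ} (hf : DifferentiableAt ℝ f p)
    (hg : DifferentiableAt ℝ g p) (i : Fin 2) :
    pd i (fun q => f q * g q) p = pd i f p * g p + f p * pd i g p := by
  simp only [pd]
  rw [fderiv_fun_mul hf hg]
  simp
  ring

lemma pd_sub {f g : ℝ × ℝ → ℝ} {p : ℝ × ℝ} (hf : DifferentiableAt ℝ f p)
    (hg : DifferentiableAt ℝ g p) (i : Fin 2) :
    pd i (f - g) p = pd i f p - pd i g p := by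
  simp only [pd]
  rw [fderiv_sub hf hg]
  simp

/-! ### The fluid domain and Green's formula -/

lemma Domain.continuous_itf (D : Domain) : Continuous D.itf :=
  D.lip_itf.elim fun _ h => h.continuous

lemma Domain.continuous_bot (D : Domain) : Continuous D.bot :=
  D.lip_bot.elim fun _ h => h.continuous

/-- The part of the strip `a < x < b` above the bottom side. -/
def Domain.above (D : Domain) : Set (ℝ × ℝ) := {p | p.1 ∈ Ioo D.a D.b ∧ D.bot p.1 < p.2}

lemma Domain.isOpen_fluid (D : Domain) : IsOpen D.fluid :=
  (isOpen_Ioo.preimage continuous_fst).inter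
    ((isOpen_lt (D.continuous_bot.comp continuous_fst) continuous_snd).inter
      (isOpen_lt continuous_snd (D.continuous_itf.comp continuous_fst)))

lemma Domain.measurableSet_fluid (D : Domain) : MeasurableSet D.fluid :=
  D.isOpen_fluid.measurableSet

lemma Domain.fluid_subset_above (D : Domain) : D.fluid ⊆ D.above := fun _ h => ⟨h.1, h.2.1⟩

/-- The shear `(x, z) ↦ (x, γ x + z)`. -/
def shear {γ : ℝ → ℝ} (hγ : Continuous γ) : ℝ × ℝ ≃ₜ ℝ × ℝ where
  toFun p := (p.1, γ p.1 + p.2)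
  invFun p := (p.1, p.2 - γ p.1)
  left_inv p := by simp
  right_inv p := by simp
  continuous_toFun := by fun_prop
  continuous_invFun := by fun_prop

lemma measurePreserving_shear {γ : ℝ → ℝ} (hγ : Continuous γ) :
    MeasurePreserving (shear hγ) (volume : Measure (ℝ × ℝ)) volume :=
  (MeasurePreserving.id (volume : Measure ℝ)).skew_product (g := fun x z => γ x + z)
    (by fun_prop) (ae_of_all _ fun x => map_add_left_eq_self volume (γ x))

/-- Integrals over the fluid domain in the coordinates that flatten the interface. -/
lemma integral_fluid_eq_shear (D : Domain) {f : ℝ × ℝ → ℝ} (hs : tsupport f ⊆ D.above) :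
    ∫ p in D.fluid, f p = ∫ q in univ ×ˢ Iio (0 : ℝ), f (q.1, D.itf q.1 + q.2) := by
  -- The support condition makes `f` vanish beside the strip and below the bottom side, so only the
  -- interface remains as a boundary.
  have h1 : ∫ p in {p : ℝ × ℝ | p.2 < D.itf p.1}, f p = ∫ p in D.fluid, f p := by
    refine setIntegral_eq_of_subset_of_forall_sdiff_eq_zero
      (measurableSet_lt measurable_snd
        (D.continuous_itf.measurable.comp measurable_fst)) (fun p hp => hp.2.2) ?_
    rintro p ⟨hp, hp'⟩
    refine image_eq_zero_of_notMem_tsupport fun hmem => hp' ?_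
    exact ⟨(hs hmem).1, (hs hmem).2, hp⟩
  rw [← h1, ← (measurePreserving_shear D.continuous_itf).setIntegral_preimage_emb
    (shear D.continuous_itf).measurableEmbedding]
  congr 2
  ext q
  simp [shear]

lemma integrable_comp_shear {γ : ℝ → ℝ} (hγ : Continuous γ) {f : ℝ × ℝ → ℝ} (hf : Continuous f)
    (hc : HasCompactSupport f) : Integrable fun q : ℝ × ℝ => f (q.1, γ q.1 + q.2) :=
  (measurePreserving_shear hγ).integrable_comp_of_integrable
    (hf.integrable_of_hasCompactSupport hc)

lemma volume_restrict_univ_prod_Iio :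
    (volume : Measure (ℝ × ℝ)).restrict (univ ×ˢ Iio (0 : ℝ))
      = (volume : Measure ℝ).prod (volume.restrict (Iio 0)) := by
  rw [Measure.volume_eq_prod, ← Measure.prod_restrict, Measure.restrict_univ]

lemma integrable_comp_shear_half {γ : ℝ → ℝ} (hγ : Continuous γ) {f : ℝ × ℝ → ℝ}
    (hf : Continuous f) (hc : HasCompactSupport f) :
    Integrable (fun q : ℝ × ℝ => f (q.1, γ q.1 + q.2))
      ((volume : Measure ℝ).prod (volume.restrict (Iio 0))) := by
  rw [← volume_restrict_univ_prod_Iio]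
  exact (integrable_comp_shear hγ hf hc).integrableOn

lemma integral_Iio_pd_one {w : ℝ × ℝ → ℝ} (hw : ContDiff ℝ 1 w) (hc : HasCompactSupport w)
    (x y : ℝ) : ∫ z in Iio 0, pd 1 w (x, y + z) = w (x, y) := by
  have hcs : HasCompactSupport fun z => w (x, y + z) := by
    refine hc.comp_isClosedEmbedding (g := fun z => (x, y + z)) ?_
    exact (Topology.IsClosedEmbedding.of_continuous_injective_isClosedMap (by fun_prop)
      (Prod.mk_right_injective x) (isClosedMap_prodMk_left x)).comp
        (Homeomorph.addLeft y).isClosedEmbedding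
  have h := hcs.integral_Iic_deriv_eq (hw.comp (by fun_prop)) 0
  simp only [Function.comp_def, add_zero] at h
  rw [← h, ← integral_Iic_eq_integral_Iio]
  refine integral_congr_ae (ae_of_all _ fun z => ?_)
  have := hasDerivAt_comp_pd (w := w) (t := z) (hw.differentiable one_ne_zero (x, y + z))
    rfl rfl (hasDerivAt_const z x) ((hasDerivAt_id z).const_add y)
  simpa using this.deriv.symm

/-- Green's formula in the vertical direction. -/
lemma integral_pd_one (D : Domain) {w : ℝ × ℝ → ℝ} (hw : ContDiff ℝ 1 w)
    (hc : HasCompactSupport w) (hs : tsupport w ⊆ D.above) :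
    ∫ p in D.fluid, pd 1 w p = ∫ x, w (x, D.itf x) := by
  rw [integral_fluid_eq_shear D ((tsupport_pd_subset w 1).trans hs),
    volume_restrict_univ_prod_Iio, integral_prod]
  · refine integral_congr_ae (ae_of_all _ fun x => ?_)
    exact integral_Iio_pd_one hw hc x (D.itf x)
  · exact integrable_comp_shear_half D.continuous_itf (continuous_pd hw 1)
      (hasCompactSupport_pd hc 1)

/-- Lipschitz functions are absolutely continuous, so the fundamental theorem of calculus applies;
both endpoint values are zero. -/
lemma integral_deriv_eq_zero_of_lipschitz {f : ℝ → ℝ} {L : NNReal} (hf : LipschitzWith L f)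
    {a b : ℝ} (hs : ∀ x, x ∉ Ioo a b → f x = 0) : ∫ x, deriv f x = 0 := by
  rcases le_or_gt b a with hab | hab
  · have : f = 0 := funext fun x => hs x (by simp [Ioo_eq_empty (not_lt.2 hab)])
    simp [this]
  have h := (hf.lipschitzOnWith
    (s := uIcc a b)).absolutelyContinuousOnInterval.integral_deriv_eq_sub
  rw [hs a (by simp), hs b (by simp), sub_zero, intervalIntegral.integral_of_le hab.le] at h
  rw [← h, ← integral_Icc_eq_integral_Ioc]
  refine (setIntegral_eq_integral_of_forall_compl_eq_zero fun x hx => ?_).symm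
  have : f =ᶠ[𝓝 x] fun _ => 0 := by
    filter_upwards [isClosed_Icc.isOpen_compl.mem_nhds hx] with y hy
    exact hs y fun h => hy (Ioo_subset_Icc_self h)
  rw [this.deriv_eq, deriv_const]

/-- Green's formula in the horizontal direction. -/
lemma integral_pd_zero (D : Domain) {w : ℝ × ℝ → ℝ} (hw : ContDiff ℝ 1 w)
    (hc : HasCompactSupport w) (hs : tsupport w ⊆ D.above) :
    ∫ p in D.fluid, pd 0 w p = - ∫ x, deriv D.itf x * w (x, D.itf x) := by
  obtain ⟨L, hL⟩ := D.lip_itf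
  have hμ := volume_restrict_univ_prod_Iio
  have i0 : Integrable (fun q : ℝ × ℝ => pd 0 w (q.1, D.itf q.1 + q.2))
      ((volume : Measure ℝ).prod (volume.restrict (Iio 0))) :=
    integrable_comp_shear_half D.continuous_itf (continuous_pd hw 0) (hasCompactSupport_pd hc 0)
  have i1' : Integrable (fun q : ℝ × ℝ => pd 1 w (q.1, D.itf q.1 + q.2))
      ((volume : Measure ℝ).prod (volume.restrict (Iio 0))) :=
    integrable_comp_shear_half D.continuous_itf (continuous_pd hw 1) (hasCompactSupport_pd hc 1)
  have i1 : Integrable (fun q : ℝ × ℝ => deriv D.itf q.1 * pd 1 w (q.1, D.itf q.1 + q.2))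
      ((volume : Measure ℝ).prod (volume.restrict (Iio 0))) :=
    i1'.bdd_mul (c := L) ((measurable_deriv D.itf).comp measurable_fst).aestronglyMeasurable
      (ae_of_all _ fun q => abs_deriv_le_of_lipschitz hL q.1)
  -- For fixed `z` the integrand is a.e. the derivative of the Lipschitz function $x\mapsto
  -- w(x,\sigma(x)+z)$, which vanishes outside $(a,b)$. The second summand is then evaluated by
  -- integrating in `z` first.
  have key : ∫ q, (pd 0 w (q.1, D.itf q.1 + q.2) + deriv D.itf q.1 * pd 1 w (q.1, D.itf q.1 + q.2))
      ∂((volume : Measure ℝ).prod (volume.restrict (Iio 0))) = 0 := by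
    refine (integral_prod_symm _ (i0.add i1)).trans ?_
    refine integral_eq_zero_of_ae (ae_of_all _ fun z => ?_)
    obtain ⟨M, hM⟩ := hw.lipschitzWith_of_hasCompactSupport hc one_ne_zero
    have hlip : LipschitzWith (M * max 1 L) fun x => w (x, D.itf x + z) := by
      refine hM.comp (LipschitzWith.prodMk LipschitzWith.id ?_)
      exact LipschitzWith.of_dist_le_mul fun x y => by simpa using hL.dist_le_mul x y
    have h0 := integral_deriv_eq_zero_of_lipschitz hlip (a := D.a) (b := D.b) fun x hx =>
      image_eq_zero_of_notMem_tsupport fun h => hx (hs h).1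
    refine Eq.trans (integral_congr_ae ?_) h0
    filter_upwards [hL.ae_differentiableAt (μ := volume)] with x hx
    have := hasDerivAt_comp_pd (w := w) (t := x) (hw.differentiable one_ne_zero (x, D.itf x + z))
        rfl rfl (hasDerivAt_id x) (hx.hasDerivAt.add_const z)
    simpa using this.deriv.symm
  rw [integral_add i0 i1] at key
  rw [integral_fluid_eq_shear D ((tsupport_pd_subset w 0).trans hs), hμ, eq_neg_iff_add_eq_zero]
  refine Eq.trans ?_ key
  congr 1
  rw [integral_prod _ i1]
  refine integral_congr_ae (ae_of_all _ fun x => ?_)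
  dsimp only
  rw [integral_const_mul]
  congr 1
  exact (integral_Iio_pd_one hw hc x (D.itf x)).symm

/-! ### Sobolev functions on the fluid domain -/

lemma Domain.exists_isCompact_fluid_subset (D : Domain) : ∃ K, IsCompact K ∧ D.fluid ⊆ K := by
  obtain ⟨m, hm⟩ := (isCompact_Icc (a := D.a) (b := D.b)).bddBelow_image
    D.continuous_bot.continuousOn
  obtain ⟨M, hM⟩ := (isCompact_Icc (a := D.a) (b := D.b)).bddAbove_image
    D.continuous_itf.continuousOn
  refine ⟨Icc D.a D.b ×ˢ Icc m M, isCompact_Icc.prod isCompact_Icc, fun p hp => ?_⟩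
  have hx := Ioo_subset_Icc_self hp.1
  exact ⟨hx, (hm (mem_image_of_mem _ hx)).trans hp.2.1.le,
    hp.2.2.le.trans (hM (mem_image_of_mem _ hx))⟩

instance Domain.isFiniteMeasure_fluid (D : Domain) :
    IsFiniteMeasure ((volume : Measure (ℝ × ℝ)).restrict D.fluid) := by
  obtain ⟨K, hK, h⟩ := D.exists_isCompact_fluid_subset
  exact ⟨by simpa using (measure_mono h).trans_lt hK.measure_lt_top⟩

lemma memLp_fluid (D : Domain) {f : ℝ × ℝ → ℝ} (hf : Continuous f) :
    MemLp f 2 (volume.restrict D.fluid) := by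
  obtain ⟨K, hK, h⟩ := D.exists_isCompact_fluid_subset
  obtain ⟨C, hC⟩ := hK.exists_bound_of_continuousOn hf.continuousOn
  exact MemLp.of_bound hf.aestronglyMeasurable C
    ((ae_restrict_iff' D.measurableSet_fluid).2 (ae_of_all _ fun p hp => hC p (h hp)))

lemma integrable_mul_fluid {D : Domain} {f g : ℝ × ℝ → ℝ}
    (hf : MemLp f 2 (volume.restrict D.fluid)) (hg : Continuous g) :
    Integrable (fun p => f p * g p) (volume.restrict D.fluid) :=
  hf.integrable_mul (memLp_fluid D hg)

lemma ae_eq_zero_of_integral_test {D : Domain} {g : ℝ × ℝ → ℝ}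
    (hg : MemLp g 2 (volume.restrict D.fluid))
    (h : ∀ φ : ℝ × ℝ → ℝ, ContDiff ℝ ∞ φ → HasCompactSupport φ → tsupport φ ⊆ D.fluid →
      ∫ p in D.fluid, g p * φ p = 0) : g =ᵐ[volume.restrict D.fluid] 0 := by
  have hi : IntegrableOn g D.fluid := hg.integrable one_le_two
  refine (ae_restrict_iff' D.measurableSet_fluid).2
    (D.isOpen_fluid.ae_eq_zero_of_integral_contDiff_smul_eq_zero hi.locallyIntegrableOn ?_)
  intro φ h1 h2 h3
  rw [← h φ h1 h2 h3]
  refine (Eq.trans (integral_congr_ae (ae_of_all _ fun p => ?_))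
    (setIntegral_eq_integral_of_forall_compl_eq_zero fun p hp => ?_).symm)
  · exact mul_comm _ _
  · rw [image_eq_zero_of_notMem_tsupport fun h => hp (h3 h), mul_zero]

/-- Since `wpd` is an arbitrary choice, this uniqueness is what makes it computable up to null sets.
-/
lemma IsWeakPartial.ae_eq {D : Domain} {i : Fin 2} {f g g' : ℝ × ℝ → ℝ}
    (hg : MemLp g 2 (volume.restrict D.fluid)) (hg' : MemLp g' 2 (volume.restrict D.fluid))
    (h : IsWeakPartial D.fluid i f g) (h' : IsWeakPartial D.fluid i f g') :
    g =ᵐ[volume.restrict D.fluid] g' := by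
  have := ae_eq_zero_of_integral_test (hg.sub hg') fun φ h1 h2 h3 => by
    simp only [Pi.sub_apply, sub_mul]
    rw [integral_sub (integrable_mul_fluid hg h1.continuous)
      (integrable_mul_fluid hg' h1.continuous), ← neg_inj, neg_sub,
      sub_eq_neg_add, ← h φ h1 h2 h3, ← neg_eq_iff_eq_neg.2 (h' φ h1 h2 h3)]
    ring
  filter_upwards [this] with p hp
  simpa [sub_eq_zero] using hp

lemma HasWeakPartial.memLp_wpd {Ω : Set (ℝ × ℝ)} {i : Fin 2} {f : ℝ × ℝ → ℝ}
    (h : HasWeakPartial Ω i f) : MemLp (wpd Ω i f) 2 (volume.restrict Ω) := by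
  rw [wpd, dif_pos h]; exact h.choose_spec.1

lemma HasWeakPartial.isWeakPartial_wpd {Ω : Set (ℝ × ℝ)} {i : Fin 2} {f : ℝ × ℝ → ℝ}
    (h : HasWeakPartial Ω i f) : IsWeakPartial Ω i f (wpd Ω i f) := by
  rw [wpd, dif_pos h]; exact h.choose_spec.2

lemma IsWeakPartial.wpd_ae_eq {D : Domain} {i : Fin 2} {f g : ℝ × ℝ → ℝ}
    (h : IsWeakPartial D.fluid i f g) (hg : MemLp g 2 (volume.restrict D.fluid)) :
    wpd D.fluid i f =ᵐ[volume.restrict D.fluid] g := by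
  have hf : HasWeakPartial D.fluid i f := ⟨g, hg, h⟩
  exact hf.isWeakPartial_wpd.ae_eq hf.memLp_wpd hg h

lemma IsWeakPartial.sub {D : Domain} {i : Fin 2} {f f' g g' : ℝ × ℝ → ℝ}
    (hf : MemLp f 2 (volume.restrict D.fluid)) (hf' : MemLp f' 2 (volume.restrict D.fluid))
    (hg : MemLp g 2 (volume.restrict D.fluid)) (hg' : MemLp g' 2 (volume.restrict D.fluid))
    (h : IsWeakPartial D.fluid i f g) (h' : IsWeakPartial D.fluid i f' g') :
    IsWeakPartial D.fluid i (f - f') (g - g') := by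
  intro φ h1 h2 h3
  have hp := continuous_pd (h1.of_le (by simp)) i
  simp only [Pi.sub_apply, sub_mul]
  rw [integral_sub (integrable_mul_fluid hf hp) (integrable_mul_fluid hf' hp),
    integral_sub (integrable_mul_fluid hg h1.continuous) (integrable_mul_fluid hg' h1.continuous),
    h φ h1 h2 h3, h' φ h1 h2 h3]
  ring

lemma IsWeakPartial.congr {Ω : Set (ℝ × ℝ)} {i : Fin 2} {f f' g : ℝ × ℝ → ℝ}
    (h : IsWeakPartial Ω i f g) (hf : f =ᵐ[volume.restrict Ω] f') : IsWeakPartial Ω i f' g := by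
  intro φ h1 h2 h3
  rw [← h φ h1 h2 h3]
  exact integral_congr_ae (by filter_upwards [hf] with p hp; rw [hp])

lemma isWeakPartial_pd (D : Domain) {f : ℝ × ℝ → ℝ} (hf : ContDiff ℝ 1 f) (i : Fin 2) :
    IsWeakPartial D.fluid i f (pd i f) := by
  intro φ h1 h2 h3
  have h1' : ContDiff ℝ 1 φ := h1.of_le (by simp)
  rw [setIntegral_eq_integral_of_forall_compl_eq_zero fun p hp => ?_,
    setIntegral_eq_integral_of_forall_compl_eq_zero fun p hp => ?_]
  · refine integral_mul_fderiv_eq_neg_fderiv_mul_of_integrable (v := dir i) ?_ ?_ ?_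
      (fun p _ => hf.differentiable one_ne_zero p) (fun p _ => h1'.differentiable one_ne_zero p)
    · exact ((continuous_pd hf i).mul h1.continuous).integrable_of_hasCompactSupport h2.mul_left
    · exact (hf.continuous.mul (continuous_pd h1' i)).integrable_of_hasCompactSupport
        (hasCompactSupport_pd h2 i).mul_left
    · exact (hf.continuous.mul h1.continuous).integrable_of_hasCompactSupport h2.mul_left
  · rw [image_eq_zero_of_notMem_tsupport fun h => hp (h3 h), mul_zero]
  · rw [image_eq_zero_of_notMem_tsupport fun h => hp (h3 (tsupport_pd_subset φ i h)), mul_zero]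

lemma wpd_ae_eq_pd (D : Domain) {f : ℝ × ℝ → ℝ} (hf : ContDiff ℝ 1 f) (i : Fin 2) :
    wpd D.fluid i f =ᵐ[volume.restrict D.fluid] pd i f :=
  (isWeakPartial_pd D hf i).wpd_ae_eq (memLp_fluid D (continuous_pd hf i))

lemma memH1_of_contDiff (D : Domain) {f : ℝ × ℝ → ℝ} (hf : ContDiff ℝ 1 f) : MemH1 D.fluid f :=
  ⟨memLp_fluid D hf.continuous, fun i =>
    ⟨pd i f, memLp_fluid D (continuous_pd hf i), isWeakPartial_pd D hf i⟩⟩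

lemma MemH1.congr {Ω : Set (ℝ × ℝ)} {f f' : ℝ × ℝ → ℝ} (h : MemH1 Ω f)
    (hf : f =ᵐ[volume.restrict Ω] f') : MemH1 Ω f' :=
  ⟨h.1.ae_eq hf, fun i =>
    ⟨wpd Ω i f, (h.2 i).memLp_wpd, (h.2 i).isWeakPartial_wpd.congr hf⟩⟩

lemma MemH1.wpd_congr {D : Domain} {f f' : ℝ × ℝ → ℝ} (h : MemH1 D.fluid f)
    (hf : f =ᵐ[volume.restrict D.fluid] f') (i : Fin 2) :
    wpd D.fluid i f' =ᵐ[volume.restrict D.fluid] wpd D.fluid i f :=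
  ((h.2 i).isWeakPartial_wpd.congr hf).wpd_ae_eq (h.2 i).memLp_wpd

lemma MemH1.sub {D : Domain} {f f' : ℝ × ℝ → ℝ} (h : MemH1 D.fluid f) (h' : MemH1 D.fluid f') :
    MemH1 D.fluid (f - f') :=
  ⟨h.1.sub h'.1, fun i => ⟨wpd D.fluid i f - wpd D.fluid i f',
    (h.2 i).memLp_wpd.sub (h'.2 i).memLp_wpd, (h.2 i).isWeakPartial_wpd.sub h.1 h'.1
      (h.2 i).memLp_wpd (h'.2 i).memLp_wpd (h'.2 i).isWeakPartial_wpd⟩⟩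

lemma MemH1.wpd_sub {D : Domain} {f f' : ℝ × ℝ → ℝ} (h : MemH1 D.fluid f)
    (h' : MemH1 D.fluid f') (i : Fin 2) :
    wpd D.fluid i (f - f') =ᵐ[volume.restrict D.fluid] wpd D.fluid i f - wpd D.fluid i f' :=
  ((h.2 i).isWeakPartial_wpd.sub h.1 h'.1 (h.2 i).memLp_wpd (h'.2 i).memLp_wpd
    (h'.2 i).isWeakPartial_wpd).wpd_ae_eq ((h.2 i).memLp_wpd.sub (h'.2 i).memLp_wpd)

/-! ### Test functions and their traces -/

/-- Smooth functions with compact support in the part of the strip above the bottom side. -/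
structure IsTest (D : Domain) (v : ℝ × ℝ → ℝ) : Prop where
  contDiff : ContDiff ℝ ∞ v
  compact : HasCompactSupport v
  supp : tsupport v ⊆ D.above

lemma IsTest.contDiff_one {D : Domain} {v : ℝ × ℝ → ℝ} (hv : IsTest D v) : ContDiff ℝ 1 v :=
  hv.contDiff.of_le (by simp)

lemma IsTest.continuous {D : Domain} {v : ℝ × ℝ → ℝ} (hv : IsTest D v) : Continuous v :=
  hv.contDiff.continuous

/-- A function of `x` extends to a test function that it controls. -/
lemma exists_test_extension (D : Domain) : ∃ M : ℝ, 0 ≤ M ∧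
    ∀ h : ℝ → ℝ, ContDiff ℝ ∞ h → HasCompactSupport h → tsupport h ⊆ Ioo D.a D.b →
      ∃ v, IsTest D v ∧ (∀ x ∈ Icc D.a D.b, v (x, D.itf x) = h x) ∧
        ∀ p, |v p| ≤ M * |h p.1| ∧ |pd 1 v p| ≤ M * |h p.1| := by
  obtain ⟨x₀, hx₀, hmin⟩ := (isCompact_Icc (a := D.a) (b := D.b)).exists_isMinOn
    (nonempty_Icc.2 D.a_lt_b.le) ((D.continuous_itf.sub D.continuous_bot).continuousOn)
  set δ := D.itf x₀ - D.bot x₀ with hδ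
  have hδ0 : 0 < δ := sub_pos.2 (D.bot_lt_itf x₀ hx₀)
  have hgap : ∀ x ∈ Icc D.a D.b, δ ≤ D.itf x - D.bot x := fun x hx => hmin hx
  obtain ⟨L, hL⟩ := D.lip_itf
  obtain ⟨s, hs, hsd⟩ := hL.uniformContinuous.exists_contDiff_dist_le
    (show 0 < δ / 8 by positivity)
  -- The smooth curve `s` is within `δ / 8` of the interface, so the interface lies where the bump
  -- is 1. The support reaches at most `δ / 2 + δ / 8` below the interface, less than the minimal
  -- gap `δ` to the bottom side.
  let B : ContDiffBump (0 : ℝ) := ⟨δ / 4, δ / 2, by positivity, by linarith⟩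
  have hB : ContDiff ℝ ∞ B := B.contDiff
  obtain ⟨M, hM⟩ := B.hasCompactSupport.deriv.exists_bound_of_continuous
    (hB.continuous_deriv (by simp))
  -- The vertical derivative falls on the bump alone, so the constant does not depend on `h`. The
  -- horizontal derivative would involve `h'` and is left uncontrolled.
  refine ⟨max 1 M, by positivity, fun h hh hc hsupp =>
    ⟨fun p => h p.1 * B (p.2 - s p.1), ?_, ?_, ?_⟩⟩
  · let K : Set (ℝ × ℝ) := (fun q : ℝ × ℝ => (q.1, s q.1 + q.2)) ''
      (tsupport h ×ˢ Metric.closedBall (0 : ℝ) (δ / 2))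
    have hK : IsCompact K := (hc.prod (isCompact_closedBall 0 (δ / 2))).image
      (continuous_fst.prodMk ((hs.continuous.comp continuous_fst).add continuous_snd))
    have hsub : ∀ p : ℝ × ℝ, p ∉ K → h p.1 * B (p.2 - s p.1) = 0 := by
      intro p hp
      by_contra hne
      obtain ⟨h1, h2⟩ := mul_ne_zero_iff.1 hne
      refine hp ⟨(p.1, p.2 - s p.1), ⟨subset_tsupport h h1, ?_⟩, by simp⟩
      exact Metric.ball_subset_closedBall (B.support_eq ▸ h2)
    have hsubK : tsupport (fun p : ℝ × ℝ => h p.1 * B (p.2 - s p.1)) ⊆ K :=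
      closure_minimal (fun p hp => by_contra fun hn => hp (hsub p hn)) hK.isClosed
    refine ⟨?_, HasCompactSupport.intro hK hsub, hsubK.trans ?_⟩
    · exact (hh.comp contDiff_fst).mul
        (hB.comp (contDiff_snd.sub (hs.comp contDiff_fst)))
    · rintro _ ⟨q, ⟨hq1, hq2⟩, rfl⟩
      have hx := hsupp hq1
      refine ⟨hx, ?_⟩
      have h1 := hgap q.1 (Ioo_subset_Icc_self hx)
      have h2 := abs_lt.1 (Real.dist_eq _ _ ▸ hsd q.1)
      have h3 := abs_le.1 (by simpa using hq2 : |q.2| ≤ δ / 2)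
      dsimp only
      linarith [h2.1, h3.1]
  · intro x _
    have h2 := abs_lt.1 (Real.dist_eq _ _ ▸ hsd x)
    have : B (D.itf x - s x) = 1 := by
      refine B.one_of_mem_closedBall ?_
      have : |D.itf x - s x| ≤ δ / 4 := abs_le.2 ⟨by linarith [h2.2], by linarith [h2.1]⟩
      simpa using this
    simp [this]
  · intro p
    have hd : HasDerivAt (fun y => h p.1 * B (y - s p.1)) (h p.1 * deriv B (p.2 - s p.1)) p.2 := by
      have := ((hB.differentiable (by simp)) (p.2 - s p.1)).hasDerivAt.comp_sub_const p.2 (s p.1)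
      exact this.const_mul _
    have hw : ContDiff ℝ ∞ fun p : ℝ × ℝ => h p.1 * B (p.2 - s p.1) :=
      (hh.comp contDiff_fst).mul (hB.comp (contDiff_snd.sub (hs.comp contDiff_fst)))
    have hd' := hasDerivAt_comp_pd (t := p.2) (hw.differentiable (by simp) (p.1, p.2)) rfl rfl
      (hasDerivAt_const p.2 p.1) (hasDerivAt_id p.2)
    have e := hd'.unique hd
    simp only [zero_mul, one_mul, zero_add, Prod.mk.eta] at e
    constructor
    · rw [abs_mul, mul_comm]
      gcongr
      rw [abs_of_nonneg B.nonneg]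
      exact B.le_one.trans (le_max_left _ _)
    · rw [e, abs_mul, mul_comm]
      gcongr
      exact (hM _).trans (le_max_right _ _)

lemma tendsto_integral_mul_of_eLpNorm {α : Type*} [MeasurableSpace α] {μ : Measure α}
    {f : ℕ → α → ℝ} {g : α → ℝ} (hf : ∀ k, AEStronglyMeasurable (f k) μ) (hg : MemLp g 2 μ)
    (h : Tendsto (fun k => eLpNorm (f k) 2 μ) atTop (𝓝 0)) :
    Tendsto (fun k => ∫ x, f k x * g x ∂μ) atTop (𝓝 0) := by
  have hle : ∀ k, eLpNorm (fun x => f k x * g x) 1 μ ≤ eLpNorm (f k) 2 μ * eLpNorm g 2 μ :=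
    fun k => by
      simpa using eLpNorm_le_eLpNorm_mul_eLpNorm_of_nnnorm (p := 2) (q := 2) (r := 1) (hf k) hg.1
        (fun a b : ℝ => a * b) 1 (ae_of_all _ fun x => by simp [nnnorm_mul])
  have hlim : Tendsto (fun k => eLpNorm (f k) 2 μ * eLpNorm g 2 μ) atTop (𝓝 0) := by
    simpa using ENNReal.Tendsto.mul_const h (Or.inr hg.2.ne)
  have h1 : Tendsto (fun k => eLpNorm (fun x => f k x * g x) 1 μ) atTop (𝓝 0) :=
    tendsto_of_tendsto_of_tendsto_of_le_of_le tendsto_const_nhds hlim (fun _ => zero_le) hle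
  have := tendsto_integral_of_L1' (μ := μ) (fun _ : α => (0 : ℝ)) aestronglyMeasurable_const
    (F := fun k x => f k x * g x) (l := atTop) ?_ ?_
  · simpa using this
  · filter_upwards [hlim.eventually_lt_const (show (0 : ℝ≥0∞) < ⊤ by simp)] with k hk
    exact memLp_one_iff_integrable.1 ⟨(hf k).mul hg.1, (hle k).trans_lt hk⟩
  · simpa [Pi.sub_def] using h1

lemma isTrace_of_test {D : Domain} {v : ℝ × ℝ → ℝ} (hv : IsTest D v) {S : Measure (ℝ × ℝ)}
    {t : ℝ × ℝ → ℝ} (ht : MemLp t 2 S) (h : v =ᵐ[S] t) : IsTrace D.fluid S v t := by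
  refine ⟨ht, fun _ => v, fun _ => hv.contDiff, by simp, fun i => ?_, ?_⟩
  · have : pd i v - wpd D.fluid i v =ᵐ[volume.restrict D.fluid] 0 := by
      filter_upwards [wpd_ae_eq_pd D hv.contDiff_one i] with p hp
      simp [hp]
    simp [eLpNorm_congr_ae this]
  · have : v - t =ᵐ[S] 0 := by
      filter_upwards [h] with p hp
      simp [hp]
    simp [eLpNorm_congr_ae this]

/-- This makes test functions admissible in the fluid step of the scheme. -/
lemma IsTest.memV {D : Domain} {v : ℝ × ℝ → ℝ} (hv : IsTest D v) :
    MemV D.fluid D.gammaF v :=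
  ⟨memH1_of_contDiff D hv.contDiff_one, isTrace_of_test hv MemLp.zero
    (ae_arclength_of_forall D.continuous_bot fun _ _ =>
      image_eq_zero_of_notMem_tsupport fun h => lt_irrefl _ (hv.supp h).2)⟩

/-- The chosen value of `trace` could a priori come from any approximating sequence, so the limit
must be shown unique. The vertical Green formula, applied to $(\varphi_k-v)E$ with $E$ extending
$h$, writes the pairing of $\varphi_k-v$ with $h$ on $\Sigma$ as volume integrals that tend to zero
by $H^1$ convergence. -/
lemma IsTrace.ae_eq_graph {D : Domain} {v t : ℝ × ℝ → ℝ} (hv : IsTest D v)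
    (h : IsTrace D.fluid D.sigma v t) :
    ∀ᵐ x ∂(volume.restrict (Ioo D.a D.b)), t (x, D.itf x) = v (x, D.itf x) := by
  obtain ⟨ht, φ, hφ, hφ0, hφ1, hφt⟩ := h
  have htg : MemLp (fun x => t (x, D.itf x)) 2 (volume.restrict (Ioo D.a D.b)) :=
    MemLp.comp_graph D.continuous_itf ht
  have hvg : Continuous fun x => v (x, D.itf x) :=
    hv.continuous.comp (continuous_id.prodMk D.continuous_itf)
  have hloc : LocallyIntegrableOn (fun x => t (x, D.itf x) - v (x, D.itf x)) (Ioo D.a D.b) :=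
    IntegrableOn.locallyIntegrableOn (Integrable.sub (htg.integrable one_le_two)
      (hvg.integrableOn_Icc.mono_set Ioo_subset_Icc_self))
  obtain ⟨M, -, hM⟩ := exists_test_extension D
  refine (ae_restrict_iff' measurableSet_Ioo).2 ?_
  have := isOpen_Ioo.ae_eq_zero_of_integral_contDiff_smul_eq_zero hloc ?_
  · filter_upwards [this] with x hx hxI
    simpa [sub_eq_zero] using hx hxI
  intro h h1 h2 h3
  obtain ⟨E, hE, hEh, -⟩ := hM h h1 h2 h3
  have hhL : MemLp h 2 (volume.restrict (Ioo D.a D.b)) :=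
    (h1.continuous.memLp_of_hasCompactSupport h2).restrict _
  have hφ1' : ∀ k, ContDiff ℝ 1 (φ k) := fun k => (hφ k).of_le (by simp)
  have green : ∀ k, ∫ x in Ioo D.a D.b, (φ k - v) (x, D.itf x) * h x
      = (∫ p in D.fluid, (φ k - v) p * pd 1 E p)
        + ∫ p in D.fluid, (pd 1 (φ k) - pd 1 v) p * E p := by
    intro k
    have hd : ContDiff ℝ 1 (φ k - v) := (hφ1' k).sub hv.contDiff_one
    have hg := integral_pd_one D (w := fun p => (φ k - v) p * E p) (hd.mul hE.contDiff_one)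
      hE.compact.mul_left ((tsupport_mul_subset_right).trans hE.supp)
    have e : ∀ p, pd 1 (fun p => (φ k - v) p * E p) p
        = (φ k - v) p * pd 1 E p + (pd 1 (φ k) - pd 1 v) p * E p := by
      intro p
      rw [pd_mul (hd.differentiable one_ne_zero p) (hE.contDiff_one.differentiable one_ne_zero p),
        pd_sub ((hφ1' k).differentiable one_ne_zero p)
          (hv.contDiff_one.differentiable one_ne_zero p)]
      simp only [Pi.sub_apply]
      ring
    simp only [e] at hg
    rw [integral_add (integrable_mul_fluid (memLp_fluid D hd.continuous)
        (continuous_pd hE.contDiff_one 1)) (integrable_mul_fluid ((memLp_fluid D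
        (continuous_pd (hφ1' k) 1)).sub (memLp_fluid D (continuous_pd hv.contDiff_one 1)))
        hE.continuous)] at hg
    refine Eq.trans ?_ ((setIntegral_eq_integral_of_forall_compl_eq_zero
      (s := Ioo D.a D.b) fun x hx => ?_).trans hg.symm)
    · refine setIntegral_congr_fun measurableSet_Ioo fun x hx => ?_
      rw [hEh x (Ioo_subset_Icc_self hx)]
    · rw [image_eq_zero_of_notMem_tsupport (f := E) fun h' => hx (hE.supp h').1, mul_zero]
  have lim1 : Tendsto (fun k => ∫ p in D.fluid, (φ k - v) p * pd 1 E p) atTop (𝓝 0) :=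
    tendsto_integral_mul_of_eLpNorm
      (fun k => ((hφ k).continuous.sub hv.continuous).aestronglyMeasurable)
      (memLp_fluid D (continuous_pd hE.contDiff_one 1)) hφ0
  have lim2 : Tendsto (fun k => ∫ p in D.fluid, (pd 1 (φ k) - pd 1 v) p * E p) atTop (𝓝 0) := by
    refine tendsto_integral_mul_of_eLpNorm (fun k => ((continuous_pd (hφ1' k) 1).sub
      (continuous_pd hv.contDiff_one 1)).aestronglyMeasurable) (memLp_fluid D hE.continuous) ?_
    refine (hφ1 1).congr fun k => eLpNorm_congr_ae ?_
    filter_upwards [wpd_ae_eq_pd D hv.contDiff_one 1] with p hp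
    simp [hp]
  have lim3 : Tendsto (fun k => ∫ x in Ioo D.a D.b, (φ k - t) (x, D.itf x) * h x) atTop (𝓝 0) := by
    refine tendsto_integral_mul_of_eLpNorm (f := fun k x => (φ k - t) (x, D.itf x)) (fun k => ?_)
      hhL ?_
    · exact (((hφ k).continuous.comp
        (continuous_id.prodMk D.continuous_itf)).aestronglyMeasurable).sub htg.1
    · exact tendsto_of_tendsto_of_tendsto_of_le_of_le tendsto_const_nhds hφt (fun _ => zero_le)
        fun k => eLpNorm_comp_graph_le D.continuous_itf _
  have hφi : ∀ k, Integrable (fun x => φ k (x, D.itf x) * h x) (volume.restrict (Ioo D.a D.b)) :=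
    fun k => ((((hφ k).continuous.comp (continuous_id.prodMk D.continuous_itf)).mul
      h1.continuous).integrable_of_hasCompactSupport h2.mul_left).restrict
  have hti : Integrable (fun x => t (x, D.itf x) * h x) (volume.restrict (Ioo D.a D.b)) :=
    htg.integrable_mul hhL
  have hvi : Integrable (fun x => v (x, D.itf x) * h x) (volume.restrict (Ioo D.a D.b)) :=
    ((hvg.mul h1.continuous).integrable_of_hasCompactSupport h2.mul_left).restrict
  have hdiff : ∀ k, ∫ x in Ioo D.a D.b, (t (x, D.itf x) - v (x, D.itf x)) * h x
      = ((∫ p in D.fluid, (φ k - v) p * pd 1 E p)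
        + ∫ p in D.fluid, (pd 1 (φ k) - pd 1 v) p * E p)
        - ∫ x in Ioo D.a D.b, (φ k - t) (x, D.itf x) * h x := by
    intro k
    rw [← green k]
    simp only [Pi.sub_apply, sub_mul]
    rw [integral_sub (hφi k) hvi, integral_sub (hφi k) hti, integral_sub hti hvi]
    ring
  have hz := tendsto_nhds_unique (tendsto_const_nhds.congr hdiff) ((lim1.add lim2).sub lim3)
  rw [← setIntegral_eq_integral_of_forall_compl_eq_zero (s := Ioo D.a D.b)]
  · simpa [mul_comm] using hz
  · intro x hx
    rw [image_eq_zero_of_notMem_tsupport fun h' => hx (h3 h'), zero_smul]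

/-- The trace of a test function on the interface is its restriction. -/
lemma IsTest.trace_graph {D : Domain} {v : ℝ × ℝ → ℝ} (hv : IsTest D v) :
    ∀ᵐ x ∂(volume.restrict (Ioo D.a D.b)),
      trace D.fluid D.sigma v (x, D.itf x) = v (x, D.itf x) := by
  obtain ⟨L, hL⟩ := D.lip_itf
  obtain ⟨C, hC⟩ := hv.compact.exists_bound_of_continuous hv.continuous
  have : IsFiniteMeasure D.sigma := isFiniteMeasure_arclength hL
  have hex : ∃ t, IsTrace D.fluid D.sigma v t := ⟨v, isTrace_of_test hv
    (MemLp.of_bound hv.continuous.aestronglyMeasurable C (ae_of_all _ hC)) (ae_eq_refl v)⟩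
  rw [trace, dif_pos hex]
  exact hex.choose_spec.ae_eq_graph hv

/-! ### Weak fluxes through the interface -/

/-- `l` is the weak flux `ν ∇f · n` on the interface of a function `f ∈ H¹(Ω_f)` whose weak
Laplacian is in `L²(Ω_f)`. -/
structure HasWeakFlux (D : Domain) (ν : ℝ) (f l : ℝ × ℝ → ℝ) : Prop where
  memH1 : MemH1 D.fluid f
  memLp : MemLp (fun x => arcDensity D.itf x * l (x, D.itf x)) 2 (volume.restrict (Ioo D.a D.b))
  eq : ∃ q : ℝ × ℝ → ℝ, MemLp q 2 (volume.restrict D.fluid) ∧ ∀ v, IsTest D v →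
    (∫ p in D.fluid, q p * v p) + ν * ∑ i, ∫ p in D.fluid, wpd D.fluid i f p * pd i v p
      = ∫ x in Ioo D.a D.b, arcDensity D.itf x * l (x, D.itf x) * v (x, D.itf x)

lemma IsTest.continuous_graph {D : Domain} {v : ℝ × ℝ → ℝ} (hv : IsTest D v) :
    Continuous fun x => v (x, D.itf x) :=
  hv.continuous.comp (continuous_id.prodMk D.continuous_itf)

lemma memLp_Ioo {a b : ℝ} {f : ℝ → ℝ} (hf : Continuous f) :
    MemLp f 2 (volume.restrict (Ioo a b)) := by
  obtain ⟨C, hC⟩ := (isCompact_Icc (a := a) (b := b)).exists_bound_of_continuousOn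
    hf.continuousOn
  exact MemLp.of_bound hf.aestronglyMeasurable C ((ae_restrict_iff' measurableSet_Ioo).2
    (ae_of_all _ fun x hx => hC x (Ioo_subset_Icc_self hx)))

lemma integrable_mul_Ioo {a b : ℝ} {f g : ℝ → ℝ} (hf : MemLp f 2 (volume.restrict (Ioo a b)))
    (hg : Continuous g) : Integrable (fun x => f x * g x) (volume.restrict (Ioo a b)) :=
  hf.integrable_mul (memLp_Ioo hg)

/-- Used twice: to pass to the errors, and then to their increments. -/
lemma HasWeakFlux.sub {D : Domain} {ν : ℝ} {f f' l l' : ℝ × ℝ → ℝ} (h : HasWeakFlux D ν f l)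
    (h' : HasWeakFlux D ν f' l') : HasWeakFlux D ν (f - f') (l - l') := by
  obtain ⟨q, hq, e⟩ := h.eq
  obtain ⟨q', hq', e'⟩ := h'.eq
  refine ⟨h.memH1.sub h'.memH1, ?_, q - q', hq.sub hq', fun v hv => ?_⟩
  · refine (h.memLp.sub h'.memLp).ae_eq (ae_of_all _ fun x => ?_)
    simp only [Pi.sub_apply]
    ring
  have hg : ∀ i, ∫ p in D.fluid, wpd D.fluid i (f - f') p * pd i v p
      = (∫ p in D.fluid, wpd D.fluid i f p * pd i v p)
        - ∫ p in D.fluid, wpd D.fluid i f' p * pd i v p := by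
    intro i
    have hc := continuous_pd hv.contDiff_one i
    rw [← integral_sub (integrable_mul_fluid (h.memH1.2 i).memLp_wpd hc)
      (integrable_mul_fluid (h'.memH1.2 i).memLp_wpd hc)]
    refine integral_congr_ae ?_
    filter_upwards [h.memH1.wpd_sub h'.memH1 i] with p hp
    rw [hp, Pi.sub_apply]
    ring
  have hI : ∫ x in Ioo D.a D.b, arcDensity D.itf x * (l - l') (x, D.itf x) * v (x, D.itf x)
      = (∫ x in Ioo D.a D.b, arcDensity D.itf x * l (x, D.itf x) * v (x, D.itf x))
        - ∫ x in Ioo D.a D.b, arcDensity D.itf x * l' (x, D.itf x) * v (x, D.itf x) := by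
    rw [← integral_sub (integrable_mul_Ioo h.memLp hv.continuous_graph)
      (integrable_mul_Ioo h'.memLp hv.continuous_graph)]
    refine integral_congr_ae (ae_of_all _ fun x => ?_)
    simp only [Pi.sub_apply]
    ring
  have hQ : ∫ p in D.fluid, (q - q') p * v p
      = (∫ p in D.fluid, q p * v p) - ∫ p in D.fluid, q' p * v p := by
    rw [← integral_sub (integrable_mul_fluid hq hv.continuous)
      (integrable_mul_fluid hq' hv.continuous)]
    refine integral_congr_ae (ae_of_all _ fun x => ?_)
    simp only [Pi.sub_apply]
    ring
  rw [hI, ← e v hv, ← e' v hv, hQ]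
  simp only [hg, Finset.sum_sub_distrib]
  ring

lemma HasWeakFlux.congr {D : Domain} {ν : ℝ} {f f' l l' : ℝ × ℝ → ℝ} (h : HasWeakFlux D ν f l)
    (hf : f =ᵐ[volume.restrict D.fluid] f') (hl : l =ᵐ[D.sigma] l') : HasWeakFlux D ν f' l' := by
  have hl' := ae_comp_graph D.continuous_itf hl
  obtain ⟨q, hq, e⟩ := h.eq
  refine ⟨h.memH1.congr hf, h.memLp.ae_eq ?_, q, hq, fun v hv => ?_⟩
  · filter_upwards [hl'] with x hx
    rw [hx]
  have hI : ∫ x in Ioo D.a D.b, arcDensity D.itf x * l' (x, D.itf x) * v (x, D.itf x)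
      = ∫ x in Ioo D.a D.b, arcDensity D.itf x * l (x, D.itf x) * v (x, D.itf x) := by
    refine integral_congr_ae ?_
    filter_upwards [hl'] with x hx
    rw [hx]
  rw [hI, ← e v hv]
  congr 2
  refine Finset.sum_congr rfl fun i _ => integral_congr_ae ?_
  filter_upwards [h.memH1.wpd_congr hf i] with p hp
  rw [hp]

/-- The arclength density cancels the normalisation of the normal, leaving the vector $(-\sigma',1)$
that Green's formulas produce. -/
lemma arcDensity_mul_fluxF (D : Domain) (ν : ℝ) (u : ℝ → ℝ × ℝ → ℝ) (t x : ℝ) :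
    arcDensity D.itf x * fluxF D ν u t (x, D.itf x)
      = ν * (pd 1 (u t) (x, D.itf x) - deriv D.itf x * pd 0 (u t) (x, D.itf x)) := by
  have h : Real.sqrt (1 + deriv D.itf x ^ 2) ≠ 0 :=
    (zero_lt_one.trans_le (one_le_arcDensity D.itf x)).ne'
  simp only [fluxF, Domain.normalF, arcDensity, Fin.sum_univ_two, if_true, Fin.isValue,
    one_ne_zero, if_false]
  field_simp
  ring

/-- The classical flux of a `C²` function is its weak flux. -/
lemma hasWeakFlux_of_contDiff (D : Domain) (ν : ℝ) {u : ℝ → ℝ × ℝ → ℝ} {t : ℝ}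
    (hu : ContDiff ℝ 2 (u t)) : HasWeakFlux D ν (u t) (fluxF D ν u t) := by
  obtain ⟨L, hL⟩ := D.lip_itf
  have hu1 : ContDiff ℝ 1 (u t) := hu.of_le one_le_two
  have hp : ∀ i, ContDiff ℝ 1 (pd i (u t)) := fun i => contDiff_pd hu (by norm_num) i
  have hpg : ∀ i, Continuous fun x => pd i (u t) (x, D.itf x) := fun i =>
    (continuous_pd hu1 i).comp (continuous_id.prodMk D.continuous_itf)
  have hσ : MemLp (fun x => deriv D.itf x * pd 0 (u t) (x, D.itf x)) 2
      (volume.restrict (Ioo D.a D.b)) :=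
    (memLp_Ioo (hpg 0)).of_le_mul (c := L)
      ((measurable_deriv D.itf).aestronglyMeasurable.mul (hpg 0).aestronglyMeasurable)
      (ae_of_all _ fun x => by
        rw [norm_mul]
        gcongr
        exact abs_deriv_le_of_lipschitz hL x)
  refine ⟨memH1_of_contDiff D hu1, ?_, fun p => ν * ∑ i, pd i (pd i (u t)) p, ?_, ?_⟩
  · simp only [arcDensity_mul_fluxF]
    exact ((memLp_Ioo (hpg 1)).sub hσ).const_mul ν
  · exact memLp_fluid D (continuous_const.mul
      (continuous_finsetSum _ fun i _ => continuous_pd (hp i) i))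
  intro v hv
  have hw : ∀ i, ContDiff ℝ 1 fun p => pd i (u t) p * v p := fun i => (hp i).mul hv.contDiff_one
  have hwc : ∀ i, HasCompactSupport fun p => pd i (u t) p * v p := fun i => hv.compact.mul_left
  have hws : ∀ i, tsupport (fun p => pd i (u t) p * v p) ⊆ D.above := fun i =>
    tsupport_mul_subset_right.trans hv.supp
  have e : ∀ i, ∫ p in D.fluid, pd i (fun p => pd i (u t) p * v p) p
      = (∫ p in D.fluid, pd i (pd i (u t)) p * v p)
        + ∫ p in D.fluid, wpd D.fluid i (u t) p * pd i v p := by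
    intro i
    have hwp : ∫ p in D.fluid, wpd D.fluid i (u t) p * pd i v p
        = ∫ p in D.fluid, pd i (u t) p * pd i v p := by
      refine integral_congr_ae ?_
      filter_upwards [wpd_ae_eq_pd D hu1 i] with p hp
      rw [hp]
    rw [hwp, ← integral_add (integrable_mul_fluid (memLp_fluid D (continuous_pd (hp i) i))
      hv.continuous) (integrable_mul_fluid (memLp_fluid D (continuous_pd hu1 i))
      (continuous_pd hv.contDiff_one i))]
    exact integral_congr_ae (ae_of_all _ fun p =>
      pd_mul ((hp i).differentiable one_ne_zero p) (hv.contDiff_one.differentiable one_ne_zero p) i)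
  have hq : ∫ p in D.fluid, (ν * ∑ i, pd i (pd i (u t)) p) * v p
      = ν * ∑ i, ∫ p in D.fluid, pd i (pd i (u t)) p * v p := by
    rw [← integral_finsetSum _ fun i _ => integrable_mul_fluid
      (memLp_fluid D (continuous_pd (hp i) i)) hv.continuous, ← integral_const_mul]
    refine integral_congr_ae (ae_of_all _ fun p => ?_)
    simp only [mul_assoc, Finset.sum_mul]
  have hz : ∀ x, x ∉ Ioo D.a D.b → v (x, D.itf x) = 0 := fun x hx =>
    image_eq_zero_of_notMem_tsupport fun h' => hx (hv.supp h').1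
  have e0 := integral_pd_zero D (hw 0) (hwc 0) (hws 0)
  have e1 := integral_pd_one D (hw 1) (hwc 1) (hws 1)
  rw [← setIntegral_eq_integral_of_forall_compl_eq_zero (s := Ioo D.a D.b)
    fun x hx => by simp [hz x hx]] at e0 e1
  calc _ = ν * ∑ i, ∫ p in D.fluid, pd i (fun p => pd i (u t) p * v p) p := by
        simp only [e]
        rw [hq, Finset.sum_add_distrib]
        ring
    _ = _ := by
        rw [Fin.sum_univ_two, e0, e1, neg_add_eq_sub, ← integral_sub
          (integrable_mul_Ioo (memLp_Ioo (hpg 1)) hv.continuous_graph), ← integral_const_mul]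
        · refine integral_congr_ae (ae_of_all _ fun x => ?_)
          simp only [arcDensity_mul_fluxF]
          ring
        · exact (integrable_mul_Ioo hσ hv.continuous_graph).congr
            (ae_of_all _ fun x => mul_assoc _ _ _)

lemma memLp_arcDensity_mul {D : Domain} {l : ℝ × ℝ → ℝ} (hl : MemLp l 2 D.sigma) :
    MemLp (fun x => arcDensity D.itf x * l (x, D.itf x)) 2 (volume.restrict (Ioo D.a D.b)) := by
  obtain ⟨L, hL⟩ := D.lip_itf
  have h := MemLp.comp_graph D.continuous_itf hl
  refine h.of_le_mul (c := 1 + L)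
    ((measurable_arcDensity D.itf).aestronglyMeasurable.mul h.1) (ae_of_all _ fun x => ?_)
  rw [norm_mul]
  gcongr
  rw [Real.norm_of_nonneg (zero_le_one.trans (one_le_arcDensity _ _))]
  exact arcDensity_le hL x

/-- The discrete fluxes of the prediction step are weak fluxes. -/
lemma IsPrediction.hasWeakFlux {D : Domain} {νf νs α dt T : ℝ} {N : ℕ} {u w : ℝ → ℝ × ℝ → ℝ}
    {w₀ u₀ lam₀ : ℕ → ℝ × ℝ → ℝ} (hu : IsSolution D νf νs T u w)
    (h : IsPrediction D νf νs α dt N u w w₀ u₀ lam₀) :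
    ∀ n ≤ N, HasWeakFlux D νf (u₀ n) (lam₀ n) := by
  intro n
  -- Induction supplies $u_0^n\in L^2(\Omega_f)$, needed for the difference quotient of the next
  -- step to be in $L^2(\Omega_f)$.
  induction n with
  | zero =>
    intro _
    exact (hasWeakFlux_of_contDiff D νf (hu.smooth_u.comp (contDiff_prodMk_right 0))).congr
      h.init_u.symm h.init_lam.symm
  | succ n ih =>
    intro hn
    have hn' : n < N := hn
    have ihn := ih hn'.le
    have hH1 := (h.mem_u n hn').1
    refine ⟨hH1, memLp_arcDensity_mul (h.mem_lam n hn'), fun p => (u₀ (n + 1) p - u₀ n p) / dt,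
      ?_, fun v hv => ?_⟩
    · simp only [div_eq_mul_inv]
      exact (hH1.1.sub ihn.memH1.1).mul_const dt⁻¹
    have e := h.step_u n hn' v hv.memV
    rw [sub_eq_zero] at e
    have hg : gradInner D.fluid (u₀ (n + 1)) v
        = ∑ i, ∫ p in D.fluid, wpd D.fluid i (u₀ (n + 1)) p * pd i v p := by
      rw [← integral_finsetSum _ fun i _ => integrable_mul_fluid (hH1.2 i).memLp_wpd
        (continuous_pd hv.contDiff_one i), gradInner]
      refine integral_congr_ae ?_
      filter_upwards [wpd_ae_eq_pd D hv.contDiff_one 0, wpd_ae_eq_pd D hv.contDiff_one 1]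
        with p h0 h1
      simp only [Fin.sum_univ_two, h0, h1]
    rw [← hg, e, Domain.sigma, integral_arclength D.continuous_itf]
    refine integral_congr_ae ?_
    filter_upwards [hv.trace_graph] with x hx
    rw [Domain.sigma] at hx
    rw [hx, mul_assoc]

/-! ### Tangential derivatives along the interface -/

/-- Mollification averages translates of `γ`, so it preserves the Lipschitz constant. The radius `ε
/ (L + 1)` keeps the error below `ε`, also when `L = 0`. -/
lemma exists_contDiff_near_of_lipschitz {γ : ℝ → ℝ} {L : NNReal} (hγ : LipschitzWith L γ) {ε : ℝ}
    (hε : 0 < ε) : ∃ s : ℝ → ℝ, ContDiff ℝ ∞ s ∧ (∀ x, |s x - γ x| ≤ ε) ∧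
      ∀ x, |deriv s x| ≤ L := by
  have hr : 0 < ε / (L + 1) := by positivity
  let φ : ContDiffBump (0 : ℝ) := ⟨ε / (L + 1) / 2, ε / (L + 1), half_pos hr, half_lt_self hr⟩
  let s : ℝ → ℝ := convolution (φ.normed volume) γ (ContinuousLinearMap.lsmul ℝ ℝ) volume
  have hi : ∀ x, Integrable fun t => φ.normed volume t * γ (x - t) := fun x =>
    ((φ.contDiff_normed (n := 0)).continuous.mul
      (hγ.continuous.comp (by fun_prop))).integrable_of_hasCompactSupport
        φ.hasCompactSupport_normed.mul_right
  have hs : ∀ x, s x = ∫ t, φ.normed volume t * γ (x - t) := fun x => rfl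
  refine ⟨s, φ.hasCompactSupport_normed.contDiff_convolution_left _ φ.contDiff_normed
    (hγ.continuous.locallyIntegrable (μ := volume)), fun x => ?_, fun x => ?_⟩
  · rw [← Real.dist_eq]
    refine φ.dist_normed_convolution_le hγ.continuous.aestronglyMeasurable fun y hy => ?_
    have h1 := hγ.dist_le_mul y x
    have h2 : dist y x < ε / (L + 1) := hy
    have h3 : (L : ℝ) * dist y x ≤ (L + 1) * (ε / (L + 1)) := by gcongr; linarith
    rw [mul_div_cancel₀ _ (by positivity)] at h3
    exact h1.trans h3
  · refine abs_deriv_le_of_lipschitz (LipschitzWith.of_dist_le_mul fun x y => ?_) x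
    rw [Real.dist_eq, hs, hs, ← integral_sub (hi x) (hi y)]
    calc |∫ t, (φ.normed volume t * γ (x - t) - φ.normed volume t * γ (y - t))|
        ≤ ∫ t, φ.normed volume t * (L * dist x y) := by
          have hφi : Integrable (φ.normed volume) := φ.integrable_normed
          rw [← Real.norm_eq_abs]
          refine norm_integral_le_of_norm_le (hφi.mul_const _) (ae_of_all _ fun t => ?_)
          rw [← mul_sub, norm_mul, Real.norm_of_nonneg (φ.nonneg_normed t)]
          refine mul_le_mul_of_nonneg_left ?_ (φ.nonneg_normed t)
          simpa [Real.dist_eq] using hγ.dist_le_mul (x - t) (y - t)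
      _ = L * dist x y := by rw [integral_mul_const, φ.integral_normed, one_mul]

/-- A smooth cutoff `ζ` that vanishes near the interface, and is constant along the translates of
a smooth graph with the same Lipschitz constant. -/
lemma exists_cutoff (D : Domain) {L : NNReal} (hL : LipschitzWith L D.itf) {ε : ℝ} (hε : 0 < ε) :
    ∃ (ζ : ℝ × ℝ → ℝ) (τ : ℝ → ℝ), ContDiff ℝ ∞ ζ ∧ ContDiff ℝ ∞ τ ∧ (∀ x, |τ x| ≤ L) ∧
      (∀ p, |ζ p| ≤ 1) ∧ tsupport ζ ⊆ {p | p.2 < D.itf p.1} ∧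
      (∀ p : ℝ × ℝ, p.2 ≤ D.itf p.1 - 4 * ε → ζ p = 1) ∧
      ∀ p, pd 0 ζ p + τ p.1 * pd 1 ζ p = 0 := by
  obtain ⟨s, hs, hsd, hsL⟩ := exists_contDiff_near_of_lipschitz hL hε
  -- `ζ` is 0 at depth at most `2ε` below `s` and 1 from depth `3ε` on; since `s` is `ε`-close to
  -- the interface, this gives the support condition and the `4 * ε`. A function of `s x - y` is
  -- annihilated by $\partial_x+s'\partial_y$, so `τ` is `deriv s`.
  let ζ : ℝ × ℝ → ℝ := fun p => Real.smoothTransition ((s p.1 - p.2) / ε - 2)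
  have hζ : ContDiff ℝ ∞ ζ := Real.smoothTransition.contDiff.comp
    ((((hs.comp contDiff_fst).sub contDiff_snd).div_const ε).sub contDiff_const)
  refine ⟨ζ, deriv s, hζ, ?_, hsL, fun p => ?_, ?_, fun p hp => ?_, fun p => ?_⟩
  · exact (contDiff_infty_iff_deriv.1 hs).2
  · exact abs_le.2 ⟨by linarith [Real.smoothTransition.nonneg ((s p.1 - p.2) / ε - 2)],
      Real.smoothTransition.le_one _⟩
  · have hcl : IsClosed {p : ℝ × ℝ | p.2 + 2 * ε ≤ s p.1} :=
      isClosed_le (by fun_prop) (hs.continuous.comp continuous_fst)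
    refine (closure_minimal (fun p hp => ?_) hcl).trans fun p hp => ?_
    · by_contra hn
      refine hp (Real.smoothTransition.zero_of_nonpos ?_)
      rw [sub_nonpos, div_le_iff₀ hε]
      have : ¬ (p.2 + 2 * ε ≤ s p.1) := hn
      linarith
    · have h1 : p.2 + 2 * ε ≤ s p.1 := hp
      have h2 := (abs_le.1 (hsd p.1)).2
      show p.2 < D.itf p.1
      linarith
  · refine Real.smoothTransition.one_of_one_le ?_
    rw [le_sub_iff_add_le, le_div_iff₀ hε]
    linarith [(abs_le.1 (hsd p.1)).1]
  · have h := hasDerivAt_comp_pd (w := ζ) (t := p.1) (X := fun t => t)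
      (Y := fun t => s t - s p.1 + p.2) (hζ.differentiable (by simp) (p.1, p.2)) rfl (by simp)
      (hasDerivAt_id _)
      (((hs.differentiable (by simp) p.1).hasDerivAt.sub_const (s p.1)).add_const p.2)
    have hc : (fun t => ζ (t, s t - s p.1 + p.2)) = fun _ => ζ p := by
      funext t
      simp only [ζ]
      congr 3
      ring
    rw [hc] at h
    simpa using h.unique (hasDerivAt_const p.1 (ζ p))

/-- For `F ∈ H¹(Ω_f)` the functional `v ↦ ∫ F ∂₁v` is controlled without horizontal derivatives
of the test function. -/
lemma abs_integral_mul_pd_zero_le (D : Domain) {L : NNReal} (hL : LipschitzWith L D.itf)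
    {F G₀ G₁ : ℝ × ℝ → ℝ} (hF : MemLp F 2 (volume.restrict D.fluid))
    (hG₀ : MemLp G₀ 2 (volume.restrict D.fluid)) (hG₁ : MemLp G₁ 2 (volume.restrict D.fluid))
    (h₀ : IsWeakPartial D.fluid 0 F G₀) (h₁ : IsWeakPartial D.fluid 1 F G₁)
    {v : ℝ × ℝ → ℝ} (hv : IsTest D v) :
    |∫ p in D.fluid, F p * pd 0 v p|
      ≤ ∫ p in D.fluid, (L * |F p| * |pd 1 v p| + (|G₀ p| + L * |G₁ p|) * |v p|) := by
  have hv0 := continuous_pd hv.contDiff_one 0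
  have hv1 := continuous_pd hv.contDiff_one 1
  have hbound : Integrable (fun p => L * |F p| * |pd 1 v p| + (|G₀ p| + L * |G₁ p|) * |v p|)
      (volume.restrict D.fluid) :=
    (integrable_mul_fluid (hF.abs.const_mul (L : ℝ)) hv1.abs).add
      (integrable_mul_fluid (hG₀.abs.add (hG₁.abs.const_mul (L : ℝ))) hv.continuous.abs)
  let ε : ℕ → ℝ := fun k => 1 / ((k : ℝ) + 1)
  have hε : ∀ k, 0 < ε k := fun k => Nat.one_div_pos_of_nat
  choose ζ τ hζ hτ hτL hζ1 hζs hζe hζτ using fun k => exists_cutoff D hL (hε k)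
  have key : ∀ k, |∫ p in D.fluid, F p * pd 0 v p * ζ k p|
      ≤ ∫ p in D.fluid, (L * |F p| * |pd 1 v p| + (|G₀ p| + L * |G₁ p|) * |v p|) := by
    intro k
    have dζ : Differentiable ℝ (ζ k) := (hζ k).differentiable (by simp)
    have dτ : ContDiff ℝ ∞ fun p : ℝ × ℝ => τ k p.1 := (hτ k).comp contDiff_fst
    have dv := hv.contDiff_one.differentiable one_ne_zero
    have hφ : ContDiff ℝ ∞ fun p => v p * ζ k p := hv.contDiff.mul (hζ k)
    have hφc : HasCompactSupport fun p => v p * ζ k p := hv.compact.mul_right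
    have hφs : tsupport (fun p => v p * ζ k p) ⊆ D.fluid := fun p hp =>
      have h1 := hv.supp (tsupport_mul_subset_left hp)
      ⟨h1.1, h1.2, hζs k (tsupport_mul_subset_right hp)⟩
    have hψ : ContDiff ℝ ∞ fun p : ℝ × ℝ => τ k p.1 * (v p * ζ k p) := dτ.mul hφ
    have e0 := h₀ _ hφ hφc hφs
    have e1 := h₁ _ hψ hφc.mul_left (tsupport_mul_subset_right.trans hφs)
    have hτ0 : ∀ p, pd 1 (fun p : ℝ × ℝ => τ k p.1) p = 0 := by
      intro p
      have h := hasDerivAt_comp_pd (w := fun p : ℝ × ℝ => τ k p.1) (t := p.2)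
        (dτ.differentiable (by simp) (p.1, p.2)) rfl rfl
        (hasDerivAt_const p.2 p.1) (hasDerivAt_id p.2)
      simpa using h.unique (hasDerivAt_const p.2 (τ k p.1))
    -- Product rule for $\partial_x(v\zeta)+\partial_y(\tau v\zeta)$: the derivatives of `ζ`, which
    -- blow up as the cutoff sharpens, cancel by tangency, and `τ` does not depend on `y`.
    have ident : ∀ p, F p * pd 0 v p * ζ k p
        = (F p * pd 0 (fun p => v p * ζ k p) p
          + F p * pd 1 (fun p : ℝ × ℝ => τ k p.1 * (v p * ζ k p)) p)
          - F p * (τ k p.1 * pd 1 v p * ζ k p) := by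
      intro p
      rw [pd_mul (dτ.differentiable (by simp) p) (hφ.differentiable (by simp) p), hτ0,
        pd_mul (dv p) (dζ p), pd_mul (dv p) (dζ p)]
      linear_combination (-F p * v p) * hζτ k p
    have c1 := continuous_pd (hφ.of_le (by simp)) 0
    have c2 := continuous_pd (hψ.of_le (by simp)) 1
    have c3 : Continuous fun p : ℝ × ℝ => τ k p.1 * pd 1 v p * ζ k p :=
      (dτ.continuous.mul hv1).mul (hζ k).continuous
    have total : ∫ p in D.fluid, F p * pd 0 v p * ζ k p
        = ∫ p in D.fluid, -(G₀ p * (v p * ζ k p) + G₁ p * (τ k p.1 * (v p * ζ k p))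
          + F p * (τ k p.1 * pd 1 v p * ζ k p)) := by
      simp only [ident]
      have s12 : Integrable (fun p => F p * pd 0 (fun p => v p * ζ k p) p
          + F p * pd 1 (fun p : ℝ × ℝ => τ k p.1 * (v p * ζ k p)) p) (volume.restrict D.fluid) :=
        (integrable_mul_fluid hF c1).add (integrable_mul_fluid hF c2)
      have s01 : Integrable (fun p => G₀ p * (v p * ζ k p) + G₁ p * (τ k p.1 * (v p * ζ k p)))
          (volume.restrict D.fluid) :=
        (integrable_mul_fluid hG₀ hφ.continuous).add (integrable_mul_fluid hG₁ hψ.continuous)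
      rw [integral_sub s12 (integrable_mul_fluid hF c3), integral_add (integrable_mul_fluid hF c1)
        (integrable_mul_fluid hF c2), e0, e1, integral_neg,
        integral_add s01 (integrable_mul_fluid hF c3),
        integral_add (integrable_mul_fluid hG₀ hφ.continuous)
          (integrable_mul_fluid hG₁ hψ.continuous)]
      ring
    rw [total, ← Real.norm_eq_abs]
    refine norm_integral_le_of_norm_le hbound (ae_of_all _ fun p => ?_)
    have t1 := hτL k p.1
    have t2 := hζ1 k p
    have hL0 : (0 : ℝ) ≤ L := L.coe_nonneg
    have b1 : |G₀ p * (v p * ζ k p)| ≤ |G₀ p| * |v p| := by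
      rw [abs_mul, abs_mul]
      gcongr
      exact mul_le_of_le_one_right (abs_nonneg _) t2
    have b2 : |G₁ p * (τ k p.1 * (v p * ζ k p))| ≤ |G₁ p| * (L * |v p|) := by
      rw [abs_mul, abs_mul, abs_mul]
      gcongr
      exact mul_le_of_le_one_right (abs_nonneg _) t2
    have b3 : |F p * (τ k p.1 * pd 1 v p * ζ k p)| ≤ |F p| * (L * |pd 1 v p|) := by
      rw [abs_mul, abs_mul, abs_mul]
      refine mul_le_mul_of_nonneg_left ?_ (abs_nonneg _)
      calc |τ k p.1| * |pd 1 v p| * |ζ k p| ≤ |τ k p.1| * |pd 1 v p| :=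
            mul_le_of_le_one_right (by positivity) t2
        _ ≤ L * |pd 1 v p| := by gcongr
    rw [norm_neg, Real.norm_eq_abs]
    refine (abs_add_three _ _ _).trans ?_
    linarith
  -- At each point of $\Omega_f$ the cutoff is eventually 1. The slopes `τ k` need not converge,
  -- because the bound in `key` uses only `|τ k| ≤ L`.
  have lim : Tendsto (fun k => ∫ p in D.fluid, F p * pd 0 v p * ζ k p) atTop
      (𝓝 (∫ p in D.fluid, F p * pd 0 v p)) := by
    have hFv := integrable_mul_fluid hF hv0
    refine tendsto_integral_of_dominated_convergence (fun p => ‖F p * pd 0 v p‖)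
      (fun k => hFv.1.mul (hζ k).continuous.aestronglyMeasurable) hFv.norm
      (fun k => ae_of_all _ fun p => ?_) ?_
    · rw [norm_mul]
      exact mul_le_of_le_one_right (norm_nonneg _) (hζ1 k p)
    · refine (ae_restrict_iff' D.measurableSet_fluid).2 (ae_of_all _ fun p hp => ?_)
      refine tendsto_const_nhds.congr' ?_
      have hd : 0 < (D.itf p.1 - p.2) / 4 := by linarith [hp.2.2]
      filter_upwards [tendsto_one_div_add_atTop_nhds_zero_nat.eventually_lt_const hd] with k hk
      rw [hζe k p (by linarith [show ε k < (D.itf p.1 - p.2) / 4 from hk]), mul_one]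
  exact le_of_tendsto lim.abs (Eventually.of_forall key)

/-! ### Duality in `L²` -/

lemma inner_toLp_eq_integral {α : Type*} [MeasurableSpace α] {μ : Measure α} {f g : α → ℝ}
    (hf : MemLp f 2 μ) (hg : MemLp g 2 μ) :
    inner ℝ (hf.toLp f) (hg.toLp g) = ∫ x, f x * g x ∂μ := by
  rw [L2.inner_def]
  refine integral_congr_ae ?_
  filter_upwards [hf.coeFn_toLp, hg.coeFn_toLp] with x h1 h2
  rw [h1, h2]
  simp [mul_comm]

lemma sq_integral_mul_le {α : Type*} [MeasurableSpace α] {μ : Measure α} {f g : α → ℝ}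
    (hf : MemLp f 2 μ) (hg : MemLp g 2 μ) :
    (∫ x, f x * g x ∂μ) ^ 2 ≤ (∫ x, f x ^ 2 ∂μ) * ∫ x, g x ^ 2 ∂μ := by
  have h := real_inner_mul_inner_self_le (hf.toLp f) (hg.toLp g)
  simp only [inner_toLp_eq_integral] at h
  simpa only [pow_two] using h

/-- The subspace of `L²(a, b)` of smooth functions with compact support in `(a, b)`. -/
def testSubmodule (a b : ℝ) : Submodule ℝ (Lp ℝ 2 (volume.restrict (Ioo a b))) where
  carrier := {x | ∃ h : ℝ → ℝ, ContDiff ℝ ∞ h ∧ HasCompactSupport h ∧ tsupport h ⊆ Ioo a b ∧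
    x =ᵐ[volume.restrict (Ioo a b)] h}
  add_mem' := by
    rintro x y ⟨h, h1, h2, h3, h4⟩ ⟨k, k1, k2, k3, k4⟩
    refine ⟨h + k, h1.add k1, h2.add k2, (tsupport_add h k).trans (union_subset h3 k3), ?_⟩
    exact (Lp.coeFn_add x y).trans (h4.add k4)
  zero_mem' := ⟨0, contDiff_const, HasCompactSupport.zero, by simp, Lp.coeFn_zero _ _ _⟩
  smul_mem' := by
    rintro c x ⟨h, h1, h2, h3, h4⟩
    refine ⟨c • h, h1.const_smul c, h2.smul_left,
      (tsupport_smul_subset_right (fun _ => c) h).trans h3, ?_⟩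
    exact (Lp.coeFn_smul c x).trans (h4.const_smul c)

/-- An element orthogonal to all test functions vanishes a.e. by the fundamental lemma of the
calculus of variations. -/
lemma dense_testSubmodule (a b : ℝ) :
    (testSubmodule a b).topologicalClosure = ⊤ := by
  rw [Submodule.topologicalClosure_eq_top_iff, Submodule.eq_bot_iff]
  intro x hx
  rw [Submodule.mem_orthogonal] at hx
  have hxm : MemLp x 2 (volume.restrict (Ioo a b)) := Lp.memLp x
  have hloc : LocallyIntegrableOn x (Ioo a b) :=
    IntegrableOn.locallyIntegrableOn (hxm.integrable one_le_two)
  rw [Lp.eq_zero_iff_ae_eq_zero]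
  refine (ae_restrict_iff' measurableSet_Ioo).2
    (isOpen_Ioo.ae_eq_zero_of_integral_contDiff_smul_eq_zero hloc fun h h1 h2 h3 => ?_)
  have hh : MemLp h 2 (volume.restrict (Ioo a b)) :=
    (h1.continuous.memLp_of_hasCompactSupport h2).restrict _
  have e := hx (hh.toLp h) ⟨h, h1, h2, h3, hh.coeFn_toLp⟩
  rw [← Lp.toLp_coeFn x hxm, inner_toLp_eq_integral] at e
  refine Eq.trans (setIntegral_eq_integral_of_forall_compl_eq_zero fun y hy => ?_).symm e
  rw [image_eq_zero_of_notMem_tsupport fun h' => hy (h3 h'), zero_smul]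

/-- The `L²` norm on an interval is tested by smooth functions with compact support. -/
lemma integral_sq_le_of_forall_test {a b B : ℝ} {m : ℝ → ℝ}
    (hm : MemLp m 2 (volume.restrict (Ioo a b))) (hB : 0 ≤ B)
    (h : ∀ h : ℝ → ℝ, ContDiff ℝ ∞ h → HasCompactSupport h → tsupport h ⊆ Ioo a b →
      (∫ x in Ioo a b, m x * h x) ^ 2 ≤ B * ∫ x in Ioo a b, h x ^ 2) :
    ∫ x in Ioo a b, m x ^ 2 ≤ B := by
  have hclosed : IsClosed {x : Lp ℝ 2 (volume.restrict (Ioo a b)) |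
      inner ℝ (hm.toLp m) x ^ 2 ≤ B * inner ℝ x x} :=
    isClosed_le (by fun_prop) (by fun_prop)
  have hsub : (testSubmodule a b : Set (Lp ℝ 2 (volume.restrict (Ioo a b)))) ⊆
      {x | inner ℝ (hm.toLp m) x ^ 2 ≤ B * inner ℝ x x} := by
    rintro x ⟨k, k1, k2, k3, k4⟩
    have hk : MemLp k 2 (volume.restrict (Ioo a b)) :=
      (k1.continuous.memLp_of_hasCompactSupport k2).restrict _
    have hx : x = hk.toLp k := Lp.ext (k4.trans hk.coeFn_toLp.symm)
    rw [hx, mem_ofPred_eq, inner_toLp_eq_integral, inner_toLp_eq_integral]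
    simpa only [pow_two] using h k k1 k2 k3
  have hmem := closure_minimal hsub hclosed
    (show hm.toLp m ∈ closure (testSubmodule a b : Set _) by
      rw [← Submodule.topologicalClosure_coe, dense_testSubmodule]
      trivial)
  rw [mem_ofPred_eq, inner_toLp_eq_integral] at hmem
  simp only [← pow_two] at hmem
  -- By density the inequality holds with `m` itself in place of the test function: $X^2\le BX$ for
  -- $X=\int m^2$, whence $X\le B$.
  have h0 : 0 ≤ ∫ x in Ioo a b, m x ^ 2 := integral_nonneg fun x => sq_nonneg _
  nlinarith

/-! ### The trace estimate for the flux -/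

lemma gradNormSq_nonneg (Ω : Set (ℝ × ℝ)) (f : ℝ × ℝ → ℝ) : 0 ≤ gradNormSq Ω f :=
  integral_nonneg fun _ => Finset.sum_nonneg fun _ _ => sq_nonneg _

lemma hessNormSq_nonneg (Ω : Set (ℝ × ℝ)) (f : ℝ × ℝ → ℝ) : 0 ≤ hessNormSq Ω f :=
  integral_nonneg fun _ => Finset.sum_nonneg fun _ _ => Finset.sum_nonneg fun _ _ => sq_nonneg _

/-- The weak flux of an `H²` function, expressed by its second derivatives. -/
lemma HasWeakFlux.integral_eq {D : Domain} {ν : ℝ} {f l : ℝ × ℝ → ℝ} (h : HasWeakFlux D ν f l)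
    (hf : MemH2 D.fluid f) {v : ℝ × ℝ → ℝ} (hv : IsTest D v) :
    ∫ x in Ioo D.a D.b, arcDensity D.itf x * l (x, D.itf x) * v (x, D.itf x)
      = ν * ∑ i, ((∫ p in D.fluid, wpd D.fluid i (wpd D.fluid i f) p * v p)
        + ∫ p in D.fluid, wpd D.fluid i f p * pd i v p) := by
  obtain ⟨q, hq, e⟩ := h.eq
  have h2 : ∀ i, MemLp (wpd D.fluid i (wpd D.fluid i f)) 2 (volume.restrict D.fluid) :=
    fun i => ((hf.2 i).2 i).memLp_wpd
  have hsum : ∀ φ : ℝ × ℝ → ℝ, Continuous φ →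
      ∫ p in D.fluid, (ν * ∑ i, wpd D.fluid i (wpd D.fluid i f) p) * φ p
        = ν * ∑ i, ∫ p in D.fluid, wpd D.fluid i (wpd D.fluid i f) p * φ p := by
    intro φ hφ
    rw [← integral_finsetSum _ fun i _ => integrable_mul_fluid (h2 i) hφ, ← integral_const_mul]
    refine integral_congr_ae (ae_of_all _ fun p => ?_)
    simp only [mul_assoc, Finset.sum_mul]
  have hΔ : MemLp (fun p => ν * ∑ i, wpd D.fluid i (wpd D.fluid i f) p) 2
      (volume.restrict D.fluid) := (memLp_finsetSum _ fun i _ => h2 i).const_mul ν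
  -- Test functions supported inside $\Omega_f$ do not see the interface, which forces $q=\nu\Delta
  -- f$ a.e.
  have hz := ae_eq_zero_of_integral_test (hq.sub hΔ) fun φ h1 h2' h3 => by
    have hφ : IsTest D φ := ⟨h1, h2', h3.trans D.fluid_subset_above⟩
    have e' := e φ hφ
    have hb : ∫ x in Ioo D.a D.b, arcDensity D.itf x * l (x, D.itf x) * φ (x, D.itf x) = 0 := by
      refine integral_eq_zero_of_ae (ae_of_all _ fun x => ?_)
      have : φ (x, D.itf x) = 0 :=
        image_eq_zero_of_notMem_tsupport fun h' => lt_irrefl _ (h3 h').2.2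
      simp [this]
    have hw : ∀ i, ∫ p in D.fluid, wpd D.fluid i f p * pd i φ p
        = - ∫ p in D.fluid, wpd D.fluid i (wpd D.fluid i f) p * φ p := fun i =>
      ((hf.2 i).2 i).isWeakPartial_wpd φ h1 h2' h3
    rw [hb] at e'
    simp only [hw, Finset.sum_neg_distrib] at e'
    simp only [Pi.sub_apply, sub_mul]
    rw [integral_sub (integrable_mul_fluid hq h1.continuous)
      (integrable_mul_fluid hΔ h1.continuous), hsum φ h1.continuous]
    linarith
  have hqv : ∫ p in D.fluid, q p * v p
      = ∫ p in D.fluid, (ν * ∑ i, wpd D.fluid i (wpd D.fluid i f) p) * v p := by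
    refine integral_congr_ae ?_
    filter_upwards [hz] with p hp
    rw [← sub_eq_zero.1 (show q p - ν * ∑ i, wpd D.fluid i (wpd D.fluid i f) p = 0 from hp)]
  rw [← e v hv, hqv, hsum v hv.continuous, Finset.sum_add_distrib]
  ring

lemma exists_integral_fluid_fst_le (D : Domain) : ∃ H : ℝ, 0 ≤ H ∧ ∀ h : ℝ → ℝ, Continuous h →
    ∫ p in D.fluid, h p.1 ^ 2 ≤ H * ∫ x in Ioo D.a D.b, h x ^ 2 := by
  obtain ⟨K, hK, hsub⟩ := D.exists_isCompact_fluid_subset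
  obtain ⟨m, hm⟩ := (hK.image continuous_snd).bddBelow
  obtain ⟨M, hM⟩ := (hK.image continuous_snd).bddAbove
  refine ⟨volume.real (Icc m M), measureReal_nonneg, fun h hh => ?_⟩
  have hc : Continuous fun p : ℝ × ℝ => h p.1 ^ 2 := (hh.comp continuous_fst).pow 2
  have hi : IntegrableOn (fun p : ℝ × ℝ => h p.1 ^ 2) (Ioo D.a D.b ×ˢ Icc m M)
      (volume.prod volume) := by
    rw [← Measure.volume_eq_prod]
    exact (hc.continuousOn.integrableOn_compact (isCompact_Icc.prod isCompact_Icc)).mono_set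
      (prod_mono Ioo_subset_Icc_self subset_rfl)
  have hle : ∫ p in D.fluid, h p.1 ^ 2 ≤ ∫ p in Ioo D.a D.b ×ˢ Icc m M, h p.1 ^ 2 := by
    refine setIntegral_mono_set (by rwa [Measure.volume_eq_prod])
      (ae_of_all _ fun p => sq_nonneg _) (ae_of_all _ fun p hp => ?_)
    exact ⟨hp.1, hm (mem_image_of_mem _ (hsub hp)), hM (mem_image_of_mem _ (hsub hp))⟩
  refine hle.trans_eq ?_
  rw [Measure.volume_eq_prod, setIntegral_prod _ hi]
  simp only [setIntegral_const, smul_eq_mul]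
  rw [integral_const_mul]

/-- The `L²` norm of the flux is controlled by the first and second derivatives. -/
theorem exists_flux_estimate (D : Domain) (ν : ℝ) : ∃ A : ℝ, 0 ≤ A ∧ ∀ f l : ℝ × ℝ → ℝ,
    HasWeakFlux D ν f l → MemH2 D.fluid f →
      ∫ p, l p ^ 2 ∂D.sigma ≤ A * (gradNormSq D.fluid f + hessNormSq D.fluid f) := by
  obtain ⟨L, hL⟩ := D.lip_itf
  obtain ⟨M, hM0, hM⟩ := exists_test_extension D
  obtain ⟨H, hH0, hH⟩ := exists_integral_fluid_fst_le D
  -- `M` comes from the extension, `H` bounds the volume norm of `h p.1` by its norm on the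
  -- interval, and 6 is the number of derivatives summed in `G`. The factor `2 * (1 + L)` dominates
  -- all coefficients: $\partial_x^2f$ occurs twice, in the Laplacian and after the tangential
  -- integration by parts.
  refine ⟨(|ν| * (2 * (1 + L) * M)) ^ 2 * (6 * H), by positivity, fun f l hl hf => ?_⟩
  let d : Fin 2 → ℝ × ℝ → ℝ := fun i => wpd D.fluid i f
  let dd : Fin 2 → Fin 2 → ℝ × ℝ → ℝ := fun i j => wpd D.fluid i (wpd D.fluid j f)
  have hd : ∀ i, MemLp (d i) 2 (volume.restrict D.fluid) := fun i => (hf.1.2 i).memLp_wpd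
  have hdd : ∀ i j, MemLp (dd i j) 2 (volume.restrict D.fluid) := fun i j =>
    ((hf.2 j).2 i).memLp_wpd
  let G : ℝ × ℝ → ℝ := fun p => (|d 0 p| + |d 1 p|)
    + (|dd 0 0 p| + |dd 0 1 p| + (|dd 1 0 p| + |dd 1 1 p|))
  have hG : MemLp G 2 (volume.restrict D.fluid) :=
    ((hd 0).abs.add (hd 1).abs).add (((hdd 0 0).abs.add (hdd 0 1).abs).add
      ((hdd 1 0).abs.add (hdd 1 1).abs))
  have hGsq : ∫ p in D.fluid, G p ^ 2 ≤ 6 * (gradNormSq D.fluid f + hessNormSq D.fluid f) := by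
    have i1 : Integrable (fun p => ∑ i, d i p ^ 2) (volume.restrict D.fluid) :=
      integrable_finsetSum _ fun i _ => (hd i).integrable_sq
    have i2 : Integrable (fun p => ∑ i, ∑ j, dd i j p ^ 2) (volume.restrict D.fluid) :=
      integrable_finsetSum _ fun i _ => integrable_finsetSum _ fun j _ => (hdd i j).integrable_sq
    have e : gradNormSq D.fluid f + hessNormSq D.fluid f
        = ∫ p in D.fluid, (∑ i, d i p ^ 2 + ∑ i, ∑ j, dd i j p ^ 2) :=
      (integral_add i1 i2).symm
    rw [e, ← integral_const_mul]
    refine integral_mono hG.integrable_sq ((i1.add i2).const_mul 6) fun p => ?_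
    have hs := sq_sum_le_card_mul_sum_sq (s := Finset.univ)
      (f := ![|d 0 p|, |d 1 p|, |dd 0 0 p|, |dd 0 1 p|, |dd 1 0 p|, |dd 1 1 p|])
    simp only [Fin.sum_univ_succ, Finset.card_univ, Fintype.card_fin] at hs ⊢
    simp [sq_abs, G] at hs ⊢
    linarith
  have key : ∀ h : ℝ → ℝ, ContDiff ℝ ∞ h → HasCompactSupport h → tsupport h ⊆ Ioo D.a D.b →
      (∫ x in Ioo D.a D.b, arcDensity D.itf x * l (x, D.itf x) * h x) ^ 2
        ≤ (|ν| * (2 * (1 + L) * M)) ^ 2 * (6 * H)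
          * (gradNormSq D.fluid f + hessNormSq D.fluid f) * ∫ x in Ioo D.a D.b, h x ^ 2 := by
    intro h h1 h2 h3
    obtain ⟨v, hv, hvh, hvM⟩ := hM h h1 h2 h3
    have hh1 : Continuous fun p : ℝ × ℝ => |h p.1| := (h1.continuous.comp continuous_fst).abs
    have hv1 := continuous_pd hv.contDiff_one 1
    have e : ∫ x in Ioo D.a D.b, arcDensity D.itf x * l (x, D.itf x) * h x
        = ν * ((∫ p in D.fluid, dd 0 0 p * v p) + (∫ p in D.fluid, d 0 p * pd 0 v p)
          + ((∫ p in D.fluid, dd 1 1 p * v p) + ∫ p in D.fluid, d 1 p * pd 1 v p)) := by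
      have := hl.integral_eq hf hv
      rw [Fin.sum_univ_two] at this
      rw [← this]
      refine setIntegral_congr_fun measurableSet_Ioo fun x hx => ?_
      simp only [hvh x (Ioo_subset_Icc_self hx)]
    -- The only term with a horizontal derivative of `v`; the others are controlled directly by
    -- `hvM`.
    have b1 := abs_integral_mul_pd_zero_le D hL (hd 0) (hdd 0 0) (hdd 1 0)
      ((hf.2 0).2 0).isWeakPartial_wpd ((hf.2 0).2 1).isWeakPartial_wpd hv
    have b2 : |∫ p in D.fluid, dd 0 0 p * v p| ≤ ∫ p in D.fluid, |dd 0 0 p| * |v p| := by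
      simpa only [abs_mul] using abs_integral_le_integral_abs (f := fun p => dd 0 0 p * v p)
        (μ := volume.restrict D.fluid)
    have b3 : |∫ p in D.fluid, dd 1 1 p * v p| ≤ ∫ p in D.fluid, |dd 1 1 p| * |v p| := by
      simpa only [abs_mul] using abs_integral_le_integral_abs (f := fun p => dd 1 1 p * v p)
        (μ := volume.restrict D.fluid)
    have b4 : |∫ p in D.fluid, d 1 p * pd 1 v p| ≤ ∫ p in D.fluid, |d 1 p| * |pd 1 v p| := by
      simpa only [abs_mul] using abs_integral_le_integral_abs (f := fun p => d 1 p * pd 1 v p)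
        (μ := volume.restrict D.fluid)
    have j1 : Integrable (fun p => L * |d 0 p| * |pd 1 v p| + (|dd 0 0 p| + L * |dd 1 0 p|) * |v p|)
        (volume.restrict D.fluid) :=
      (integrable_mul_fluid ((hd 0).abs.const_mul (L : ℝ)) hv1.abs).add (integrable_mul_fluid
        ((hdd 0 0).abs.add ((hdd 1 0).abs.const_mul (L : ℝ))) hv.continuous.abs)
    have j2 : Integrable (fun p => |dd 0 0 p| * |v p|) (volume.restrict D.fluid) :=
      integrable_mul_fluid (hdd 0 0).abs hv.continuous.abs
    have j3 : Integrable (fun p => |dd 1 1 p| * |v p|) (volume.restrict D.fluid) :=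
      integrable_mul_fluid (hdd 1 1).abs hv.continuous.abs
    have j4 : Integrable (fun p => |d 1 p| * |pd 1 v p|) (volume.restrict D.fluid) :=
      integrable_mul_fluid (hd 1).abs hv1.abs
    have total : |∫ x in Ioo D.a D.b, arcDensity D.itf x * l (x, D.itf x) * h x|
        ≤ |ν| * (2 * (1 + L) * M) * ∫ p in D.fluid, G p * |h p.1| := by
      rw [e, abs_mul, mul_assoc]
      refine mul_le_mul_of_nonneg_left ?_ (abs_nonneg ν)
      rw [← integral_const_mul]
      calc _ ≤ (∫ p in D.fluid, |dd 0 0 p| * |v p|)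
            + (∫ p in D.fluid, (L * |d 0 p| * |pd 1 v p|
              + (|dd 0 0 p| + L * |dd 1 0 p|) * |v p|))
            + ((∫ p in D.fluid, |dd 1 1 p| * |v p|) + ∫ p in D.fluid, |d 1 p| * |pd 1 v p|) :=
            (abs_add_le _ _).trans (add_le_add ((abs_add_le _ _).trans (add_le_add b2 b1))
              ((abs_add_le _ _).trans (add_le_add b3 b4)))
        _ = ∫ p in D.fluid, ((|dd 0 0 p| * |v p| + (L * |d 0 p| * |pd 1 v p|
              + (|dd 0 0 p| + L * |dd 1 0 p|) * |v p|))
            + (|dd 1 1 p| * |v p| + |d 1 p| * |pd 1 v p|)) := by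
            rw [← integral_add j2 j1, ← integral_add j3 j4]
            exact (integral_add (j2.add j1) (j3.add j4)).symm
        _ ≤ _ := by
            refine integral_mono ((j2.add j1).add (j3.add j4))
              ((integrable_mul_fluid hG hh1).const_mul _) fun p => ?_
            obtain ⟨p1, p2⟩ := hvM p
            have hL0 : (0 : ℝ) ≤ L := L.coe_nonneg
            have hR : 0 ≤ M * |h p.1| := by positivity
            have q1 : (2 * |dd 0 0 p| + L * |dd 1 0 p| + |dd 1 1 p|) * |v p|
                ≤ (2 * |dd 0 0 p| + L * |dd 1 0 p| + |dd 1 1 p|) * (M * |h p.1|) := by gcongr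
            have q2 : (L * |d 0 p| + |d 1 p|) * |pd 1 v p|
                ≤ (L * |d 0 p| + |d 1 p|) * (M * |h p.1|) := by gcongr
            have q3 : (2 * |dd 0 0 p| + L * |dd 1 0 p| + |dd 1 1 p|) + (L * |d 0 p| + |d 1 p|)
                ≤ 2 * (1 + L) * G p := by
              have a0 := abs_nonneg (d 0 p)
              have a1 := abs_nonneg (d 1 p)
              have a2 := abs_nonneg (dd 0 0 p)
              have a3 := abs_nonneg (dd 0 1 p)
              have a4 := abs_nonneg (dd 1 0 p)
              have a5 := abs_nonneg (dd 1 1 p)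
              have := mul_nonneg hL0 a0
              have := mul_nonneg hL0 a1
              have := mul_nonneg hL0 a2
              have := mul_nonneg hL0 a3
              have := mul_nonneg hL0 a4
              have := mul_nonneg hL0 a5
              simp only [G]
              linarith
            have q4 := mul_le_mul_of_nonneg_right q3 hR
            dsimp only
            linarith
    have hcs := sq_integral_mul_le hG (memLp_fluid D hh1)
    simp only [sq_abs] at hcs
    calc _ = |∫ x in Ioo D.a D.b, arcDensity D.itf x * l (x, D.itf x) * h x| ^ 2 :=
          (sq_abs _).symm
      _ ≤ (|ν| * (2 * (1 + L) * M) * ∫ p in D.fluid, G p * |h p.1|) ^ 2 := by gcongr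
      _ = (|ν| * (2 * (1 + L) * M)) ^ 2 * (∫ p in D.fluid, G p * |h p.1|) ^ 2 := mul_pow _ _ _
      _ ≤ (|ν| * (2 * (1 + L) * M)) ^ 2 * ((6 * (gradNormSq D.fluid f + hessNormSq D.fluid f))
            * (H * ∫ x in Ioo D.a D.b, h x ^ 2)) := by
          refine mul_le_mul_of_nonneg_left (hcs.trans ?_) (sq_nonneg _)
          have := gradNormSq_nonneg D.fluid f
          have := hessNormSq_nonneg D.fluid f
          exact mul_le_mul hGsq (hH h h1.continuous) (integral_nonneg fun _ => sq_nonneg _)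
            (by positivity)
      _ = _ := by ring
  have hg := gradNormSq_nonneg D.fluid f
  have hh := hessNormSq_nonneg D.fluid f
  -- Duality bounds the weighted flux $\rho l$ in $L^2(dx)$, where $\rho$ is the arclength density.
  -- Since $\rho\ge1$, $\rho l^2\le(\rho l)^2$.
  refine le_trans ?_ (integral_sq_le_of_forall_test hl.memLp (by positivity) key)
  rw [Domain.sigma, integral_arclength D.continuous_itf]
  refine integral_mono_of_nonneg (ae_of_all _ fun x => ?_) hl.memLp.integrable_sq
    (ae_of_all _ fun x => ?_)
  · exact mul_nonneg (Real.sqrt_nonneg _) (sq_nonneg _)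
  · have h1 := one_le_arcDensity D.itf x
    simp only [mul_pow]
    refine mul_le_mul_of_nonneg_right ?_ (sq_nonneg _)
    nlinarith

end RobinCoupling

end

theorem corollary3p2 (D : RobinCoupling.Domain) (T νf : ℝ) (hT : 0 < T) (hνf : 0 < νf) :
    ∃ K : ℝ, 0 < K ∧
      ∀ (νs α : ℝ), 0 < νs → 0 < α →
      ∀ (u w : ℝ → ℝ × ℝ → ℝ), RobinCoupling.IsSolution D νf νs T u w →
      ∀ (N : ℕ) (dt : ℝ), 0 < dt → T = N * dt →
      ∀ (w₀ u₀ lam₀ : ℕ → ℝ × ℝ → ℝ),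
        RobinCoupling.IsPrediction D νf νs α dt N u w w₀ u₀ lam₀ →
      ∀ (C Y : ℝ), RobinCoupling.IncrementEstimate D dt N u u₀ C Y →
        dt * ∑ n ∈ Finset.range N,
            (∫ p, (RobinCoupling.errLam D νf dt u lam₀ (n + 1) p
              - RobinCoupling.errLam D νf dt u lam₀ n p) ^ 2 ∂D.sigma)
          ≤ K * C * dt ^ 4 * Y := by

  obtain ⟨A, hA, hest⟩ := RobinCoupling.exists_flux_estimate D νf
  -- The gradient part is summed by its maximum, giving the factor $N\Delta t=T$; the Hessian part
  -- contributes the 1. `A + 1` secures positivity.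
  refine ⟨(A + 1) * (T + 1), by positivity, ?_⟩
  intro νs α _ _ u w hu N dt hdt hTN w₀ u₀ lam₀ hp C Y hinc
  obtain ⟨hH2, hsum⟩ := hinc
  have hflux : ∀ n ≤ N, RobinCoupling.HasWeakFlux D νf (RobinCoupling.errU dt u u₀ n)
      (RobinCoupling.errLam D νf dt u lam₀ n) := fun n hn =>
    (RobinCoupling.hasWeakFlux_of_contDiff D νf
      (hu.smooth_u.comp (contDiff_prodMk_right (n * dt)))).sub (hp.hasWeakFlux hu n hn)
  have hN : 0 < N := Nat.pos_of_ne_zero fun h => by simp [h] at hTN; exact hT.ne' hTN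
  let g : ℕ → ℝ := fun n => RobinCoupling.gradNormSq D.fluid
    (RobinCoupling.errU dt u u₀ (n + 1) - RobinCoupling.errU dt u u₀ n)
  let k : ℕ → ℝ := fun n => RobinCoupling.hessNormSq D.fluid
    (RobinCoupling.errU dt u u₀ (n + 1) - RobinCoupling.errU dt u u₀ n)
  have hg : ∀ n, 0 ≤ g n := fun n => RobinCoupling.gradNormSq_nonneg _ _
  have hk : ∀ n, 0 ≤ k n := fun n => RobinCoupling.hessNormSq_nonneg _ _
  have hS : 0 ≤ dt * ∑ n ∈ Finset.range N, k n :=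
    mul_nonneg hdt.le (Finset.sum_nonneg fun n _ => hk n)
  have hm : ∀ m < N, g m + dt * ∑ n ∈ Finset.range N, k n ≤ C * dt ^ 4 * Y := hsum
  -- `C` and `Y` have no prescribed sign; the estimate at index 0, available because `T > 0`
  -- excludes `N = 0`, makes the right-hand side nonnegative.
  have hX : 0 ≤ C * dt ^ 4 * Y := (add_nonneg (hg 0) hS).trans (hm 0 hN)
  calc _ ≤ dt * ∑ n ∈ Finset.range N, A * (g n + k n) := by
        refine mul_le_mul_of_nonneg_left (Finset.sum_le_sum fun n hn => ?_) hdt.le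
        have hn' : n < N := Finset.mem_range.1 hn
        exact hest _ _ ((hflux (n + 1) hn').sub (hflux n hn'.le)) (hH2 n hn')
    _ = A * (dt * ∑ n ∈ Finset.range N, g n + dt * ∑ n ∈ Finset.range N, k n) := by
        rw [← Finset.mul_sum, Finset.sum_add_distrib]
        ring
    _ ≤ A * (dt * ∑ _n ∈ Finset.range N, C * dt ^ 4 * Y + C * dt ^ 4 * Y) := by
        refine mul_le_mul_of_nonneg_left (add_le_add (mul_le_mul_of_nonneg_left
          (Finset.sum_le_sum fun n hn => ?_) hdt.le) ?_) hA
        · linarith [hm n (Finset.mem_range.1 hn)]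
        · linarith [hm 0 hN, hg 0]
    _ = A * (T + 1) * (C * dt ^ 4 * Y) := by
        rw [Finset.sum_const, Finset.card_range, nsmul_eq_mul, hTN]
        ring
    _ ≤ (A + 1) * (T + 1) * (C * dt ^ 4 * Y) := by gcongr; linarith
    _ = (A + 1) * (T + 1) * C * dt ^ 4 * Y := by ring
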